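/- Let $G$ be a connected, locally finite simple graph, and let $G_1\subseteq G_2\subseteq\cdots$ be finite subgraphs of $G$ whose union is $G$. For a finite graph $F$ let $H(F)$ be its Hashimoto matrix: it is indexed by the arcs (directed edges) of $F$, with $H(F)_{a,b}=1$ if the head of $a$ is the tail of $b$ and $b$ is not the reverse of $a$, and $H(F)_{a,b}=0$ otherwise; let $\rho(H(F))$ be its spectral radius (taken to be $0$ if $F$ has no edges). In site percolation on $G$ with parameter $p\in[0,1]$ each vertex is open with probability $p$, independently of the others, and the clusters are the connected components of the subgraph induced by the open vertices. Let $p_u$ be the infimum of all $p\in[0,1]$ such that almost surely there is exactly one infinite cluster ($p_u=\infty$ if there is no such $p$, as for a finite graph). Then the limit $\rho_0=\lim_{t\to\infty}\rho(H(G_t))\in[0,\infty]$ exists, and $$p_u\ \ge\ \frac1{\rho_0}$$ if $\rho_0\neq 0$ (with $1/\infty=0$), while $p_u\ge 1$ if $\rho_0=0$. -/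

import Mathlib

open Filter Topology MeasureTheory
open scoped ENNReal

namespace SitePercolation

universe u

variable {V : Type u}

open Classical in
/-- The Hashimoto (non-backtracking) matrix of a graph, indexed by its arcs (darts): the entry at
`(a, b)` is `1` if the head of `a` is the tail of `b` and `b` is not the reverse of `a`, and it
is `0` otherwise. -/
noncomputable def hashimoto (G : SimpleGraph V) : Matrix G.Dart G.Dart ℂ :=
  Matrix.of fun a b => if a.snd = b.fst ∧ b ≠ a.symm then 1 else 0

/-- A finite graph has finitely many arcs. -/
instance finite_dart (G : SimpleGraph V) [Finite V] : Finite G.Dart :=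
  Finite.of_injective _ (SimpleGraph.Dart.toProd_injective (G := G))

open Classical in
/-- The spectral radius (largest modulus of a complex eigenvalue) of the Hashimoto matrix of a
finite graph. It is `0` for a graph without edges. -/
noncomputable def hashimotoRadius (G : SimpleGraph V) [Finite V] : ℝ≥0∞ :=
  letI : Fintype G.Dart := Fintype.ofFinite G.Dart
  spectralRadius ℂ (hashimoto G)

/-- For the set `ω` of open vertices: the subgraph induced by the open vertices has exactly one
infinite connected component. -/
def HasUniqueInfiniteCluster (G : SimpleGraph V) (ω : Set V) : Prop :=
  ∃! C : (G.induce ω).ConnectedComponent, C.supp.Infinite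

/-- The uniqueness transition of site percolation: the infimum of the `p ∈ [0, 1]` for which there
is almost surely exactly one infinite open cluster, every vertex being open with probability `p`
independently of the others (`∞` if there is no such `p`, as on a finite graph). -/
noncomputable def uniquenessTransition (G : SimpleGraph V) : ℝ≥0∞ :=
  ⨅ (p : unitInterval)
    (_ : ∀ᵐ ω ∂(ProbabilityTheory.setBernoulli (Set.univ : Set V) p),
      HasUniqueInfiniteCluster G ω),
    ENNReal.ofReal (p : ℝ)

end SitePercolation

/-! Let ρ₀ be the supremum of the radii, and suppose that the infinite cluster is almost surely
unique at some p < 1 with pρ₀ < 1. Sprinkle: add an independent configuration of density ε > 0 so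
small that q = p + (1 - p)ε still satisfies qρ₀ < 1. Cycles open in the union of the two
configurations then give a contradiction.

Long cycles are rare. A cycle of length n through c is a closed non-backtracking walk, so there are
at most deg(c)ρ₀ⁿ of them (`card_cycles_le`), each open with probability at most qⁿ. The sum
converges, so almost surely the open cycles through c have bounded length.

Long cycles exist. For p < 1 uniqueness survives the closing of finitely many vertices. A vertex v
is pivotal for x if closing it cuts x off, even in the union, from the infinite cluster of the first
configuration. Sprinkling can supply the missing pivotal vertex for at most one v, so the
probabilities of being pivotal are summable and x has finitely many pivotal vertices
(`ae_finite_pivotal`). Pivotality is a strict order on the cluster, so some c has none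
(`exists_percolates_forall_not_pivotal`). No single vertex then separates c from the infinite
cluster outside a given ball, and a Menger-type argument (`exists_isCycle_meeting`) yields an open
cycle through c leaving that ball. -/

namespace SitePercolation

/-! ### Spectral radius of natural-number matrices and walk counting -/

section IntegerMatrix

variable {ι κ : Type*} [Fintype ι] [DecidableEq ι] [Fintype κ] [DecidableEq κ]

/-- The largest row sum of a matrix of natural numbers. -/
noncomputable def maxRowSum (A : Matrix ι ι ℕ) : ℝ≥0∞ :=
  ⨆ i, ∑ j, (A i j : ℝ≥0∞)

omit [DecidableEq ι] in
theorem entry_le_maxRowSum (A : Matrix ι ι ℕ) (i j : ι) : (A i j : ℝ≥0∞) ≤ maxRowSum A :=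
  le_trans (Finset.single_le_sum (f := fun j => (A i j : ℝ≥0∞)) (fun _ _ => zero_le)
    (Finset.mem_univ j)) (le_iSup (fun i => ∑ j, (A i j : ℝ≥0∞)) i)

/-- Gelfand's formula for the ℓ∞ operator norm, which is the largest row sum when the entries are
non-negative. All later spectral bounds reduce to counting through it. -/
theorem maxRowSum_pow_rpow_tendsto (A : Matrix ι ι ℕ) :
    Tendsto (fun n : ℕ => maxRowSum (A ^ n) ^ (1 / n : ℝ)) atTop
      (𝓝 (spectralRadius ℂ (A.map (Nat.cast : ℕ → ℂ)))) := by
  let _ : NormedRing (Matrix ι ι ℂ) := Matrix.linftyOpNormedRing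
  let _ : NormedAlgebra ℂ (Matrix ι ι ℂ) := Matrix.linftyOpNormedAlgebra
  have key := spectrum.pow_nnnorm_pow_one_div_tendsto_nhds_spectralRadius
    (A.map (Nat.cast : ℕ → ℂ))
  refine key.congr fun n => ?_
  have hpow : (A.map (Nat.cast : ℕ → ℂ)) ^ n = (A ^ n).map (Nat.cast : ℕ → ℂ) :=
    (map_pow (Nat.castRingHom ℂ).mapMatrix A n).symm
  rw [hpow]
  congr 1
  have := Matrix.linfty_opNNNorm_def ((A ^ n).map (Nat.cast : ℕ → ℂ))
  rw [this, maxRowSum, ENNReal.coe_finset_sup, Finset.sup_univ_eq_iSup]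
  refine iSup_congr fun i => ?_
  simp

theorem map_pow_apply_le {A : Matrix ι ι ℕ} {B : Matrix κ κ ℕ} {f : ι → κ}
    (hf : Function.Injective f) (h : ∀ i j, A i j ≤ B (f i) (f j)) (n : ℕ) (i j : ι) :
    (A ^ n) i j ≤ (B ^ n) (f i) (f j) := by
  induction n generalizing i with
  | zero => simp [Matrix.one_apply, hf.eq_iff]
  | succ n ih =>
    rw [pow_succ', pow_succ', Matrix.mul_apply, Matrix.mul_apply]
    calc ∑ k, A i k * (A ^ n) k j ≤ ∑ k, B (f i) (f k) * (B ^ n) (f k) (f j) :=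
          Finset.sum_le_sum fun k _ => Nat.mul_le_mul (h i k) (ih k)
      _ = ∑ k ∈ Finset.univ.map ⟨f, hf⟩, B (f i) k * (B ^ n) k (f j) := by simp
      _ ≤ _ := Finset.sum_le_sum_of_subset (Finset.subset_univ _)

theorem spectralRadius_mono {A : Matrix ι ι ℕ} {B : Matrix κ κ ℕ} {f : ι → κ}
    (hf : Function.Injective f) (h : ∀ i j, A i j ≤ B (f i) (f j)) :
    spectralRadius ℂ (A.map (Nat.cast : ℕ → ℂ)) ≤ spectralRadius ℂ (B.map (Nat.cast : ℕ → ℂ)) := by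
  refine le_of_tendsto_of_tendsto' (maxRowSum_pow_rpow_tendsto A)
    (maxRowSum_pow_rpow_tendsto B) fun n => ?_
  refine ENNReal.rpow_le_rpow ?_ (by positivity)
  refine iSup_le fun i => le_trans ?_ (le_iSup _ (f i))
  calc ∑ j, ((A ^ n) i j : ℝ≥0∞) ≤ ∑ j, ((B ^ n) (f i) (f j) : ℝ≥0∞) :=
        Finset.sum_le_sum fun j _ => by exact_mod_cast map_pow_apply_le hf h n i j
    _ = ∑ k ∈ Finset.univ.map ⟨f, hf⟩, ((B ^ n) (f i) k : ℝ≥0∞) := by simp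
    _ ≤ _ := Finset.sum_le_sum_of_subset (Finset.subset_univ _)

theorem diag_pow_le (A : Matrix ι ι ℕ) (i : ι) (k : ℕ) : (A i i) ^ k ≤ (A ^ k) i i := by
  induction k with
  | zero => simp
  | succ k ih =>
    rw [pow_succ, pow_succ, Matrix.mul_apply]
    exact (Nat.mul_le_mul_right _ ih).trans
      (Finset.single_le_sum (f := fun j => (A ^ k) i j * A j i) (fun _ _ => Nat.zero_le _)
        (Finset.mem_univ i))

/-- Closed walks at `i` can be concatenated, so diagonal entries are supermultiplicative, and
Gelfand's formula along multiples of `n` loses no subexponential factor. -/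
theorem diag_pow_le_spectralRadius_pow (A : Matrix ι ι ℕ) (i : ι) {n : ℕ} (hn : n ≠ 0) :
    ((A ^ n) i i : ℝ≥0∞) ≤ spectralRadius ℂ (A.map (Nat.cast : ℕ → ℂ)) ^ n := by
  have hn0 : (n : ℝ) ≠ 0 := by exact_mod_cast hn
  -- The shift to `k + 1` excludes the power 0, where the exponent `1 / 0 = 0` would break the
  -- comparison.
  have hsub : Tendsto (fun k : ℕ => n * (k + 1)) atTop atTop :=
    tendsto_atTop_mono (fun k => Nat.le_mul_of_pos_left _ (Nat.pos_of_ne_zero hn))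
      (tendsto_add_atTop_nat 1)
  have h := (maxRowSum_pow_rpow_tendsto A).comp hsub
  have hle : ((A ^ n) i i : ℝ≥0∞) ^ (1 / n : ℝ) ≤
      spectralRadius ℂ (A.map (Nat.cast : ℕ → ℂ)) := by
    refine ge_of_tendsto' h fun k => ?_
    have hk0 : ((k : ℝ) + 1) ≠ 0 := by positivity
    have h1 : (((A ^ n) i i : ℝ≥0∞)) ^ (k + 1) ≤ maxRowSum (A ^ (n * (k + 1))) := by
      refine le_trans ?_ (entry_le_maxRowSum _ i i)
      rw [pow_mul]
      exact_mod_cast diag_pow_le (A ^ n) i (k + 1)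
    calc ((A ^ n) i i : ℝ≥0∞) ^ (1 / n : ℝ)
        = (((A ^ n) i i : ℝ≥0∞) ^ (k + 1)) ^ (1 / (n * (k + 1) : ℕ) : ℝ) := by
          rw [← ENNReal.rpow_natCast, ← ENNReal.rpow_mul]
          congr 1
          push_cast
          field_simp
      _ ≤ _ := ENNReal.rpow_le_rpow h1 (by positivity)
  calc ((A ^ n) i i : ℝ≥0∞) = (((A ^ n) i i : ℝ≥0∞) ^ (1 / n : ℝ)) ^ n := by
        rw [← ENNReal.rpow_natCast, ← ENNReal.rpow_mul, one_div_mul_cancel hn0, ENNReal.rpow_one]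
    _ ≤ _ := pow_le_pow_left' hle n

/-- Either `A` is nilpotent, or every power has a non-zero natural entry and hence a row sum at
least 1. This later forces p < 1 whenever p < 1/ρ₀. -/
theorem spectralRadius_eq_zero_or_one_le (A : Matrix ι ι ℕ) :
    spectralRadius ℂ (A.map (Nat.cast : ℕ → ℂ)) = 0 ∨
      1 ≤ spectralRadius ℂ (A.map (Nat.cast : ℕ → ℂ)) := by
  by_cases h : ∃ n, A ^ n = 0
  · obtain ⟨n, hn⟩ := h
    left
    refine tendsto_nhds_unique (maxRowSum_pow_rpow_tendsto A) ?_
    refine tendsto_const_nhds.congr' ?_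
    filter_upwards [eventually_ge_atTop (n + 1)] with m hm
    have : A ^ m = 0 := pow_eq_zero_of_le (by omega) hn
    have hm0 : (0 : ℝ) < 1 / m := by
      have : 0 < m := by omega
      positivity
    rw [this]
    simp only [maxRowSum, Matrix.zero_apply, Nat.cast_zero, Finset.sum_const_zero,
      ENNReal.iSup_zero]
    rw [ENNReal.zero_rpow_of_pos hm0]
  · push Not at h
    right
    refine ge_of_tendsto' (maxRowSum_pow_rpow_tendsto A) fun n => ?_
    have : ∃ i j, (A ^ n) i j ≠ 0 := by
      by_contra hc
      push Not at hc
      exact h n (Matrix.ext hc)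
    obtain ⟨i, j, hij⟩ := this
    have h1 : 1 ≤ maxRowSum (A ^ n) :=
      le_trans (by exact_mod_cast Nat.one_le_iff_ne_zero.mpr hij) (entry_le_maxRowSum _ i j)
    exact (ENNReal.one_rpow (1 / n : ℝ)).symm.le.trans (ENNReal.rpow_le_rpow h1 (by positivity))

/-- The lists `l` of length `n` such that `i :: l` is a walk from `i` to `j` along nonzero entries
of the matrix `A`. -/
def supportWalks (A : Matrix ι ι ℕ) : ℕ → ι → ι → Finset (List ι)
  | 0, i, j => if i = j then {[]} else ∅
  | n + 1, i, j =>
    (Finset.univ.filter fun k => A i k ≠ 0).biUnion fun k =>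
      (supportWalks A n k j).image (List.cons k)

/-- The matrix power counts each walk with a product of non-zero natural weights, thus at least
once. -/
theorem card_supportWalks_le (A : Matrix ι ι ℕ) (n : ℕ) (i j : ι) :
    (supportWalks A n i j).card ≤ (A ^ n) i j := by
  induction n generalizing i with
  | zero =>
    by_cases h : i = j <;> simp [supportWalks, h]
  | succ n ih =>
    rw [pow_succ', Matrix.mul_apply, supportWalks]
    refine Finset.card_biUnion_le.trans ?_
    refine le_trans (Finset.sum_le_sum (g := fun k => A i k * (A ^ n) k j) fun k hk => ?_)
      (Finset.sum_le_sum_of_subset (Finset.filter_subset _ _))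
    refine Finset.card_image_le.trans ((ih k).trans ?_)
    exact Nat.le_mul_of_pos_left _ (Nat.pos_of_ne_zero (Finset.mem_filter.mp hk).2)

theorem append_singleton_mem_supportWalks (A : Matrix ι ι ℕ) (l : List ι) (i j : ι)
    (h : List.IsChain (fun a b => A a b ≠ 0) (i :: (l ++ [j]))) :
    l ++ [j] ∈ supportWalks A (l.length + 1) i j := by
  induction l generalizing i with
  | nil =>
    simp only [List.nil_append, List.isChain_cons_cons] at h
    simp [supportWalks, h.1]
  | cons a l ih =>
    simp only [List.cons_append, List.isChain_cons_cons] at h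
    rw [List.length_cons, supportWalks, Finset.mem_biUnion]
    exact ⟨a, by simp [h.1], Finset.mem_image_of_mem _ (ih a h.2)⟩

end IntegerMatrix

/-! ### Hashimoto radii and the number of cycles -/

section Radius

variable {V W : Type*}

open Classical in
/-- The Hashimoto matrix with natural number entries. -/
noncomputable def natHashimoto (G : SimpleGraph V) : Matrix G.Dart G.Dart ℕ :=
  Matrix.of fun a b => if a.snd = b.fst ∧ b ≠ a.symm then 1 else 0

theorem natHashimoto_ne_zero {G : SimpleGraph V} {a b : G.Dart} :
    natHashimoto G a b ≠ 0 ↔ a.snd = b.fst ∧ b ≠ a.symm := by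
  classical
  simp [natHashimoto]

theorem natHashimoto_map (G : SimpleGraph V) :
    (natHashimoto G).map (Nat.cast : ℕ → ℂ) = hashimoto G := by
  classical
  ext a b
  simp only [natHashimoto, hashimoto, Matrix.map_apply, Matrix.of_apply]
  split_ifs <;> simp

theorem hashimotoRadius_eq (G : SimpleGraph V) [Finite V] [Fintype G.Dart] [DecidableEq G.Dart] :
    hashimotoRadius G = spectralRadius ℂ ((natHashimoto G).map (Nat.cast : ℕ → ℂ)) := by
  rw [natHashimoto_map, hashimotoRadius]
  congr!

theorem mapDart_injective {X : SimpleGraph V} {Y : SimpleGraph W} (f : X →g Y)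
    (hf : Function.Injective f) : Function.Injective f.mapDart := by
  intro a b h
  have h1 := congrArg SimpleGraph.Dart.toProd h
  apply SimpleGraph.Dart.toProd_injective
  simpa [SimpleGraph.Hom.mapDart, hf.eq_iff, Prod.ext_iff] using h1

theorem natHashimoto_mapDart_ne_zero {X : SimpleGraph V} {Y : SimpleGraph W} (f : X →g Y)
    (hf : Function.Injective f) (a b : X.Dart) :
    natHashimoto Y (f.mapDart a) (f.mapDart b) ≠ 0 ↔ natHashimoto X a b ≠ 0 := by
  rw [natHashimoto_ne_zero, natHashimoto_ne_zero]
  have h1 : (f.mapDart a).symm = f.mapDart a.symm := rfl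
  rw [h1, (mapDart_injective f hf).ne_iff]
  exact and_congr_left fun _ => hf.eq_iff

theorem natHashimoto_le_mapDart {X : SimpleGraph V} {Y : SimpleGraph W} (f : X →g Y)
    (hf : Function.Injective f) (a b : X.Dart) :
    natHashimoto X a b ≤ natHashimoto Y (f.mapDart a) (f.mapDart b) := by
  classical
  have h1 : natHashimoto X a b ≤ 1 := by
    simp only [natHashimoto, Matrix.of_apply]; split_ifs <;> simp
  have := natHashimoto_mapDart_ne_zero f hf a b
  by_cases h : natHashimoto X a b = 0
  · simp [h]
  · have := this.mpr h
    omega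

theorem hashimotoRadius_mono {X : SimpleGraph V} {Y : SimpleGraph W} [Finite V] [Finite W]
    (f : X →g Y) (hf : Function.Injective f) : hashimotoRadius X ≤ hashimotoRadius Y := by
  classical
  have : Fintype X.Dart := Fintype.ofFinite _
  have : Fintype Y.Dart := Fintype.ofFinite _
  rw [hashimotoRadius_eq, hashimotoRadius_eq]
  exact spectralRadius_mono (mapDart_injective f hf) (natHashimoto_le_mapDart f hf)

theorem hashimotoRadius_eq_zero_or_one_le (X : SimpleGraph V) [Finite V] :
    hashimotoRadius X = 0 ∨ 1 ≤ hashimotoRadius X := by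
  classical
  have : Fintype X.Dart := Fintype.ofFinite _
  rw [hashimotoRadius_eq]
  exact spectralRadius_eq_zero_or_one_le _

/-- Consecutive darts of a cycle, cyclically, have nonzero entries in the Hashimoto matrix. -/
theorem isChain_natHashimoto_of_isCycle {G : SimpleGraph V} {c : V} {w : G.Walk c c}
    (hw : w.IsCycle) {a : G.Dart} {l : List G.Dart} (hl : w.darts = a :: l) :
    List.IsChain (fun a b => natHashimoto G a b ≠ 0) (a :: (l ++ [a])) := by
  have hnd : w.edges.Nodup := hw.edges_nodup
  have hlen := hw.three_le_length
  rw [SimpleGraph.Walk.edges, hl] at hnd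
  have hllen : l.length + 1 = w.length := by
    rw [← SimpleGraph.Walk.length_darts, hl, List.length_cons]
  have hadj : List.IsChain G.DartAdj w.darts := w.isChain_dartAdj_darts
  rw [hl] at hadj
  -- A backtrack would repeat an edge, and the edges of a cycle are distinct. This serves also for
  -- the wrap-around pair of last and first dart.
  have hne : ∀ x y : G.Dart, x.edge ≠ y.edge → y ≠ x.symm := by
    rintro x y h rfl
    exact h (by simp)
  have hl0 : l ≠ [] := by
    rintro rfl
    simp at hllen
    omega
  have key : List.IsChain (fun a b => natHashimoto G a b ≠ 0) (a :: l) := by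
    rw [List.nodup_iff_pairwise_ne, List.pairwise_map] at hnd
    rw [List.isChain_iff_getElem] at hadj ⊢
    intro i hi
    refine natHashimoto_ne_zero.mpr ⟨hadj i hi, hne _ _ ?_⟩
    rw [List.pairwise_iff_getElem] at hnd
    exact hnd i (i + 1) (by omega) hi (by omega)
  rw [← List.cons_append]
  refine List.isChain_append.mpr ⟨key, by simp, ?_⟩
  intro x hx y hy
  simp only [List.head?_cons, Option.mem_def, Option.some.injEq] at hy
  subst hy
  rw [List.getLast?_cons_of_ne_nil hl0] at hx
  obtain ⟨h0, hx'⟩ := List.mem_getLast?_eq_getLast hx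
  refine natHashimoto_ne_zero.mpr ⟨?_, hne _ _ ?_⟩
  · have hfst := w.map_fst_darts_append
    have hsnd := w.cons_map_snd_darts
    have h1 : a.fst = c := by
      have := congrArg List.head? hfst
      rw [hl, ← hsnd] at this
      simpa using this
    have h2 : x.snd = c := by
      have h3 := congrArg List.getLast? hsnd
      rw [hl, List.getLast?_eq_getLast_of_ne_nil w.support_ne_nil, w.getLast_support] at h3
      simp only [List.map_cons] at h3
      rw [List.getLast?_cons_of_ne_nil (by simp), List.getLast?_cons_of_ne_nil (by simpa),
        List.getLast?_map, List.getLast?_eq_getLast_of_ne_nil hl0] at h3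
      rw [hx']
      simpa using h3
    rw [h1, h2]
  · rw [List.map_cons, List.nodup_cons] at hnd
    intro h
    apply hnd.1
    rw [← h, hx']
    exact List.mem_map_of_mem (List.getLast_mem _)

theorem exists_forall_adj_of_iSup_eq_top {G : SimpleGraph V} {S : ℕ → G.Subgraph}
    (hmono : Monotone S) (hlim : ⨆ t, S t = ⊤) (D : Finset G.Dart) :
    ∃ t, ∀ d ∈ D, (S t).Adj d.fst d.snd := by
  have h (d : G.Dart) : ∃ t, (S t).Adj d.fst d.snd := by
    have : (⨆ t, S t).Adj d.fst d.snd := by rw [hlim]; exact d.adj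
    simpa using this
  choose f hf using h
  refine ⟨D.sup f, fun d hd => ?_⟩
  exact (hmono (Finset.le_sup hd)).2 (hf d)

/-- The number of cycles of length `n` through a vertex is bounded by the `n`-th power of the limit
of the spectral radii. -/
theorem card_cycles_le (G : SimpleGraph V) [G.LocallyFinite] {S : ℕ → G.Subgraph}
    [∀ t, Finite (S t).verts] (hmono : Monotone S) (hlim : ⨆ t, S t = ⊤) (c : V) (n : ℕ)
    (C : Finset (G.Walk c c)) (hC : ∀ w ∈ C, w.IsCycle ∧ w.length = n) :
    (C.card : ℝ≥0∞) ≤ G.degree c * (⨆ t, hashimotoRadius (S t).coe) ^ n := by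
  classical
  obtain ⟨t, ht⟩ := exists_forall_adj_of_iSup_eq_top hmono hlim
    (C.biUnion fun w => w.darts.toFinset)
  have ht' : ∀ w ∈ C, ∀ d ∈ w.darts, (S t).Adj d.fst d.snd := fun w hw d hd =>
    ht d (Finset.mem_biUnion.mpr ⟨w, hw, by simpa using hd⟩)
  have : Fintype (S t).coe.Dart := Fintype.ofFinite _
  let φ : (S t).coe.Dart → G.Dart := (S t).hom.mapDart
  have hφinj : Function.Injective φ := mapDart_injective _ (S t).hom_injective
  have hφ : ∀ w ∈ C, ∀ d ∈ w.darts, ∃ d', φ d' = d := fun w hw d hd =>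
    ⟨⟨(⟨d.fst, (S t).edge_vert (ht' w hw d hd)⟩,
      ⟨d.snd, (S t).edge_vert (ht' w hw d hd).symm⟩), ht' w hw d hd⟩, rfl⟩
  have hmaps : ∀ w ∈ C, w.snd ∈ G.neighborFinset c := fun w hw => by
    rw [SimpleGraph.mem_neighborFinset]
    exact w.adj_snd (hC w hw).1.not_nil
  -- Sorting the cycles by their first arc `a` accounts for the factor deg(c); each class is bounded
  -- by the diagonal entry at `a` of the n-th Hashimoto power.
  rw [Finset.card_eq_sum_card_fiberwise hmaps, ← SimpleGraph.card_neighborFinset_eq_degree]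
  push_cast
  rw [← nsmul_eq_mul]
  refine Finset.sum_le_card_nsmul _ _ _ fun v hv => ?_
  set F := C.filter fun w => w.snd = v
  rcases F.eq_empty_or_nonempty with h0 | ⟨w₀, hw₀⟩
  · simp [h0]
  have hn : n ≠ 0 := by
    have h1 := hC w₀ (Finset.mem_filter.mp hw₀).1
    have := h1.1.three_le_length
    omega
  have hv' : G.Adj c v := by simpa using hv
  let a : G.Dart := ⟨(c, v), hv'⟩
  have hdarts : ∀ w ∈ F, w.darts = a :: w.darts.tail := by
    intro w hw
    obtain ⟨hwC, hwv⟩ := Finset.mem_filter.mp hw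
    cases w with
    | nil => exact absurd (hC _ hwC).1 SimpleGraph.Walk.not_isCycle_nil
    | cons h p =>
      simp only [SimpleGraph.Walk.snd_cons] at hwv
      subst hwv
      simp [a]
  obtain ⟨a', ha'⟩ := hφ w₀ (Finset.mem_filter.mp hw₀).1 a (by rw [hdarts w₀ hw₀]; simp)
  have hcard : F.card ≤
      ((supportWalks (natHashimoto (S t).coe) n a' a').image (List.map φ)).card := by
    -- `supportWalks` omits the starting index and keeps the final one, so `a` moves from the front
    -- to the end.
    refine Finset.card_le_card_of_injOn (fun w => w.darts.tail ++ [a]) ?_ ?_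
    · intro w hw
      have hwC := (Finset.mem_filter.mp hw).1
      have hl : w.darts.tail.length + 1 = n := by
        have := congrArg List.length (hdarts w hw)
        rw [List.length_cons, SimpleGraph.Walk.length_darts, (hC w hwC).2] at this
        exact this.symm
      have hchain := isChain_natHashimoto_of_isCycle (hC w hwC).1 (hdarts w hw)
      obtain ⟨l, hl'⟩ : ∃ l : List (S t).coe.Dart, l.map φ = w.darts.tail := by
        have : w.darts.tail ∈ Set.range (List.map φ) := by
          rw [Set.range_list_map]
          intro d hd
          exact hφ w hwC d (List.mem_of_mem_tail hd)
        exact this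
      refine Finset.mem_coe.mpr (Finset.mem_image.mpr ⟨l ++ [a'], ?_, by simp [hl', ha']⟩)
      have hln : n = l.length + 1 := by rw [← hl, ← hl', List.length_map]
      rw [hln]
      apply append_singleton_mem_supportWalks (natHashimoto (S t).coe)
      have h2 : a :: (w.darts.tail ++ [a]) = (a' :: (l ++ [a'])).map φ := by
        simp [hl', ha']
      rw [h2, List.isChain_map] at hchain
      exact hchain.imp fun x y h => (natHashimoto_mapDart_ne_zero _ (S t).hom_injective x y).mp h
    · intro w hw w' hw' h
      apply SimpleGraph.Walk.darts_injective
      rw [hdarts w hw, hdarts w' hw', List.append_cancel_right h]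
  calc (F.card : ℝ≥0∞) ≤ ((natHashimoto (S t).coe ^ n) a' a' : ℝ≥0∞) := by
        exact_mod_cast hcard.trans (Finset.card_image_le.trans
          (card_supportWalks_le (natHashimoto (S t).coe) _ _ _))
    _ ≤ hashimotoRadius (S t).coe ^ n := by
        rw [hashimotoRadius_eq]
        exact diag_pow_le_spectralRadius_pow (natHashimoto (S t).coe) _ hn
    _ ≤ _ := pow_le_pow_left' (le_iSup (fun t => hashimotoRadius (S t).coe) t) n

theorem hashimotoRadius_coe_monotone {G : SimpleGraph V} {S : ℕ → G.Subgraph}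
    [∀ t, Finite (S t).verts] (hmono : Monotone S) :
    Monotone fun t => hashimotoRadius (S t).coe := fun _ _ h =>
  hashimotoRadius_mono (SimpleGraph.Subgraph.inclusion (hmono h))
    (SimpleGraph.Subgraph.inclusion.injective (hmono h))

end Radius

/-! ### Resampling one vertex and closing finitely many -/

section Resampling

open Measure ProbabilityTheory unitInterval

theorem measurable_update_fst_snd {ι : Type*} [DecidableEq ι] {X : ι → Type*}
    [∀ i, MeasurableSpace (X i)] (v : ι) :
    Measurable fun z : X v × (∀ i, X i) => Function.update z.2 v z.1 := by
  refine measurable_pi_lambda _ fun i => ?_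
  by_cases h : i = v
  · subst h
    simpa using measurable_fst
  · simp only [Function.update_of_ne h]
    exact (measurable_pi_apply i).comp measurable_snd

/-- Resampling one coordinate leaves an infinite product measure invariant. -/
theorem infinitePi_map_update {ι : Type*} [DecidableEq ι] {X : ι → Type*}
    {mX : ∀ i, MeasurableSpace (X i)} (μ : ∀ i, Measure (X i)) [∀ i, IsProbabilityMeasure (μ i)]
    (v : ι) :
    ((μ v).prod (infinitePi μ)).map (fun z => Function.update z.2 v z.1) = infinitePi μ := by
  have hmeas := measurable_update_fst_snd (X := X) v
  refine eq_infinitePi μ fun s t ht => ?_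
  rw [map_apply hmeas (MeasurableSet.pi s.countable_toSet fun i _ => ht i)]
  have h1 : (fun z : X v × (∀ i, X i) => Function.update z.2 v z.1) ⁻¹' (s : Set ι).pi t =
      (if v ∈ s then t v else Set.univ) ×ˢ ((s.erase v : Finset ι) : Set ι).pi t := by
    ext ⟨x, f⟩
    simp only [Set.mem_preimage, Set.mem_pi, Set.mem_prod, Finset.coe_erase, Finset.mem_coe,
      Set.mem_sdiff, Set.mem_singleton_iff]
    constructor
    · intro h
      refine ⟨?_, fun i hi => ?_⟩
      · split_ifs with hv
        · simpa using h v hv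
        · trivial
      · simpa [Function.update_of_ne hi.2] using h i hi.1
    · rintro ⟨hx, hf⟩ i hi
      by_cases h : i = v
      · subst h
        simpa [hi] using hx
      · simpa [Function.update_of_ne h] using hf i ⟨hi, h⟩
  rw [h1, prod_prod, infinitePi_pi μ fun i _ => ht i]
  split_ifs with hv
  · rw [Finset.mul_prod_erase s (fun i => μ i (t i)) hv]
  · rw [measure_univ, one_mul, Finset.erase_eq_of_notMem hv]

variable {V : Type*} [Countable V]

/-- The status of one vertex is independent of every event that ignores this vertex. -/
theorem setBernoulli_inter_eq_mul (p : I) (v : V) {D : Set (Set V)} (hD : MeasurableSet D)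
    (hinv : ∀ ω, insert v ω ∈ D ↔ ω ∈ D) (T : Set Prop) :
    setBernoulli Set.univ p {ω | (v ∈ ω) ∈ T ∧ ω ∈ D} =
      (toNNReal p • dirac True + toNNReal (σ p) • dirac False : Measure Prop) T *
        setBernoulli Set.univ p D := by
  classical
  set P : Measure Prop := toNNReal p • dirac True + toNNReal (σ p) • dirac False with hP
  have hset : setBernoulli (Set.univ : Set V) p =
      (infinitePi fun _ : V => P).map (fun f : V → Prop => {i | f i}) := by
    rw [setBernoulli_eq_map]
    simp [hP]
  have : IsProbabilityMeasure P := by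
    rw [hP]
    infer_instance
  have hm : Measurable (fun f : V → Prop => {i | f i}) := MeasurableEquiv.setOfPred.measurable
  have hmem : MeasurableSet {ω : Set V | (v ∈ ω) ∈ T ∧ ω ∈ D} := by
    refine MeasurableSet.inter ?_ hD
    exact (measurable_set_mem v) (MeasurableSet.of_discrete (s := T))
  have hup := measurable_update_fst_snd (X := fun _ : V => Prop) v
  rw [hset, map_apply hm hmem, map_apply hm hD]
  -- With `v` resampled independently and `D` blind to `v`, the event becomes a rectangle.
  conv_lhs => rw [← infinitePi_map_update (fun _ : V => P) v]
  rw [map_apply hup (hm hmem)]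
  have key : (fun z : Prop × (V → Prop) => Function.update z.2 v z.1) ⁻¹'
      ((fun f : V → Prop => {i | f i}) ⁻¹' {ω | (v ∈ ω) ∈ T ∧ ω ∈ D}) =
      T ×ˢ ((fun f : V → Prop => {i | f i}) ⁻¹' D) := by
    ext ⟨x, f⟩
    simp only [Set.mem_preimage, Set.mem_prod, Set.mem_ofPred_eq, Function.update_self]
    refine and_congr_right fun _ => ?_
    have h2 : insert v {i | Function.update f v x i} = insert v {i | f i} := by
      ext i
      by_cases h : i = v
      · simp [h]
      · simp [h]
    rw [← hinv, h2, hinv]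
  rw [key, prod_prod]

theorem setBernoulli_mem_inter (p : I) (v : V) {D : Set (Set V)} (hD : MeasurableSet D)
    (hinv : ∀ ω, insert v ω ∈ D ↔ ω ∈ D) :
    setBernoulli Set.univ p {ω | v ∈ ω ∧ ω ∈ D} =
      toNNReal p * setBernoulli Set.univ p D := by
  have := setBernoulli_inter_eq_mul p v hD hinv {x | x}
  simpa using this

theorem setBernoulli_notMem_inter (p : I) (v : V) {D : Set (Set V)} (hD : MeasurableSet D)
    (hinv : ∀ ω, insert v ω ∈ D ↔ ω ∈ D) :
    setBernoulli Set.univ p {ω | v ∉ ω ∧ ω ∈ D} =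
      toNNReal (σ p) * setBernoulli Set.univ p D := by
  have := setBernoulli_inter_eq_mul p v hD hinv {x | ¬ x}
  simpa using this

omit [Countable V] in
theorem measurable_sdiff_const (B : Set V) : Measurable fun ω : Set V => ω \ B := by
  rw [measurable_set_iff]
  intro a
  exact (measurable_set_mem a).and measurable_const

/-- Closing a vertex is absolutely continuous below density one. -/
theorem ae_sdiff_singleton {p : I} (hp : p ≠ 1) (v : V) {Q : Set V → Prop}
    (hQ : ∀ᵐ ω ∂setBernoulli (Set.univ : Set V) p, Q ω) :
    ∀ᵐ ω ∂setBernoulli (Set.univ : Set V) p, Q (ω \ {v}) := by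
  obtain ⟨N, hN, hNm, hN0⟩ := exists_measurable_superset_of_null (ae_iff.mp hQ)
  -- This preimage ignores `v`, and its part with `v` closed lies in the null set `N`. As `v` is
  -- closed with positive probability, the whole preimage is null.
  have h1 := setBernoulli_notMem_inter p v (D := (fun ω => ω \ {v}) ⁻¹' N)
    (measurable_sdiff_const _ hNm) (fun ω => by simp)
  have h2 : setBernoulli Set.univ p {ω | v ∉ ω ∧ ω ∈ (fun ω => ω \ {v}) ⁻¹' N} = 0 := by
    refine measure_mono_null ?_ hN0
    rintro ω ⟨hv, hω⟩
    simpa [Set.sdiff_singleton_eq_self hv] using hω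
  rw [h2] at h1
  have h3 : (toNNReal (σ p) : ℝ≥0∞) ≠ 0 := by
    simp only [ne_eq, ENNReal.coe_eq_zero]
    intro h
    apply hp
    have := congrArg NNReal.toReal h
    simp at this
    ext
    change (p : ℝ) = 1
    linarith
  have h4 := (mul_eq_zero.mp h1.symm).resolve_left h3
  exact ae_iff.mpr (measure_mono_null (fun ω hω => hN (a := ω \ {v}) hω) h4)

theorem ae_forall_finset_sdiff {p : I} (hp : p ≠ 1) {Q : Set V → Prop}
    (hQ : ∀ᵐ ω ∂setBernoulli (Set.univ : Set V) p, Q ω) :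
    ∀ᵐ ω ∂setBernoulli (Set.univ : Set V) p, ∀ B : Finset V, Q (ω \ B) := by
  classical
  rw [ae_all_iff]
  intro B
  induction B using Finset.induction_on with
  | empty => simpa using hQ
  | insert v B _ ih =>
    filter_upwards [ae_sdiff_singleton hp v ih] with ω hω
    rwa [Finset.coe_insert, Set.insert_eq, ← Set.sdiff_sdiff]

end Resampling

/-! ### Clusters in terms of vertices -/

section Clusters

variable {V : Type*} {G : SimpleGraph V} {ω ω' : Set V} {x y v : V}

/-- The graph on all vertices whose edges are the edges of `G` between open vertices. -/
def openSubgraph (G : SimpleGraph V) (ω : Set V) : SimpleGraph V where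
  Adj x y := G.Adj x y ∧ x ∈ ω ∧ y ∈ ω
  symm := ⟨fun _ _ h => ⟨h.1.symm, h.2.2, h.2.1⟩⟩
  loopless := ⟨fun x h => G.loopless.irrefl x h.1⟩

/-- The vertices `x` and `y` are equal or joined by an open path. -/
def Joined (G : SimpleGraph V) (ω : Set V) (x y : V) : Prop :=
  (openSubgraph G ω).Reachable x y

/-- The vertex `x` belongs to an infinite open cluster. -/
def Percolates (G : SimpleGraph V) (ω : Set V) (x : V) : Prop :=
  {y | Joined G ω x y}.Infinite

theorem openSubgraph_mono (h : ω ⊆ ω') : openSubgraph G ω ≤ openSubgraph G ω' :=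
  fun _ _ ha => ⟨ha.1, h ha.2.1, h ha.2.2⟩

theorem Joined.refl (x : V) : Joined G ω x x := SimpleGraph.Reachable.refl x

theorem Joined.symm (h : Joined G ω x y) : Joined G ω y x := SimpleGraph.Reachable.symm h

theorem Joined.trans {z : V} (h : Joined G ω x y) (h' : Joined G ω y z) : Joined G ω x z :=
  SimpleGraph.Reachable.trans h h'

theorem Joined.mono (h : ω ⊆ ω') (hj : Joined G ω x y) : Joined G ω' x y :=
  SimpleGraph.Reachable.mono (openSubgraph_mono h) hj

theorem Percolates.mono (h : ω ⊆ ω') (hx : Percolates G ω x) : Percolates G ω' x :=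
  Set.Infinite.mono (fun _ hy => Joined.mono h hy) hx

theorem Percolates.of_joined (hx : Percolates G ω x) (h : Joined G ω x y) : Percolates G ω y :=
  Set.Infinite.mono (fun _ hz => h.symm.trans hz) hx

theorem Joined.mem_left (h : Joined G ω x y) (hne : x ≠ y) : x ∈ ω := by
  obtain ⟨w⟩ := h
  cases w with
  | nil => exact absurd rfl hne
  | cons h _ => exact h.2.1

/-- Closed vertices are isolated in `openSubgraph`. -/
theorem Percolates.mem (h : Percolates G ω x) : x ∈ ω := by
  obtain ⟨y, hy, hne⟩ := h.exists_notMem_finset {x}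
  exact Joined.mem_left hy fun h => hne (by simp [h])

/-- The infinite open cluster exists and is unique, in terms of vertices. -/
def UniquePercolation (G : SimpleGraph V) (ω : Set V) : Prop :=
  (∃ x, Percolates G ω x) ∧ ∀ x y, Percolates G ω x → Percolates G ω y → Joined G ω x y

theorem joined_iff_induce_reachable (hx : x ∈ ω) (hy : y ∈ ω) :
    Joined G ω x y ↔ (G.induce ω).Reachable ⟨x, hx⟩ ⟨y, hy⟩ := by
  constructor
  · rintro ⟨w⟩
    induction w with
    | nil => exact SimpleGraph.Reachable.refl _
    | cons h _ ih =>
      have h1 : (G.induce ω).Adj ⟨_, hx⟩ ⟨_, h.2.2⟩ := h.1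
      exact h1.reachable.trans (ih h.2.2 hy)
  · intro h
    let f : G.induce ω →g openSubgraph G ω :=
      ⟨Subtype.val, fun {a b} h => ⟨h, a.2, b.2⟩⟩
    exact h.map f

theorem percolates_iff_supp_infinite (hx : x ∈ ω) :
    Percolates G ω x ↔ ((G.induce ω).connectedComponentMk ⟨x, hx⟩).supp.Infinite := by
  have h : {y | Joined G ω x y} =
      Subtype.val '' ((G.induce ω).connectedComponentMk ⟨x, hx⟩).supp := by
    ext y
    simp only [Set.mem_ofPred_eq, Set.mem_image, SimpleGraph.ConnectedComponent.mem_supp_iff,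
      SimpleGraph.ConnectedComponent.eq]
    constructor
    · intro hj
      have hy : y ∈ ω := by
        by_cases hxy : x = y
        · exact hxy ▸ hx
        · exact hj.symm.mem_left (Ne.symm hxy)
      exact ⟨⟨y, hy⟩, ((joined_iff_induce_reachable hx hy).mp hj).symm, rfl⟩
    · rintro ⟨z, hz, rfl⟩
      exact (joined_iff_induce_reachable hx z.2).mpr hz.symm
  rw [Percolates, h, Set.infinite_image_iff Subtype.val_injective.injOn]

theorem HasUniqueInfiniteCluster.uniquePercolation (h : HasUniqueInfiniteCluster G ω) :
    UniquePercolation G ω := by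
  obtain ⟨C, hC, huniq⟩ := h
  have hcomp : ∀ x (hx : Percolates G ω x), (G.induce ω).connectedComponentMk ⟨x, hx.mem⟩ = C :=
    fun x hx => huniq _ ((percolates_iff_supp_infinite hx.mem).mp hx)
  constructor
  · induction C using SimpleGraph.ConnectedComponent.ind with
    | h x => exact ⟨x, (percolates_iff_supp_infinite x.2).mpr hC⟩
  · intro x y hx hy
    rw [joined_iff_induce_reachable hx.mem hy.mem, ← SimpleGraph.ConnectedComponent.eq,
      hcomp x hx, hcomp y hy]

end Clusters

/-! ### Measurability of connection events -/

section Measurability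

variable {V : Type*} [Countable V] {G : SimpleGraph V} {Ω : Type*} [MeasurableSpace Ω]

/-- Walks are sorted by length and first step, both countable. The map `f` allows configurations
modified at a vertex and unions of two. -/
theorem measurableSet_joined (G : SimpleGraph V) {f : Ω → Set V} (hf : Measurable f) (x y : V) :
    MeasurableSet {a | Joined G (f a) x y} := by
  have key : ∀ (n : ℕ) (x : V),
      MeasurableSet {a | ∃ w : (openSubgraph G (f a)).Walk x y, w.length = n} := by
    intro n
    induction n with
    | zero =>
      intro x
      have : {a | ∃ w : (openSubgraph G (f a)).Walk x y, w.length = 0} = {_a : Ω | x = y} := by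
        ext a
        simp
      rw [this]
      exact MeasurableSet.const _
    | succ n ih =>
      intro x
      have : {a | ∃ w : (openSubgraph G (f a)).Walk x y, w.length = n + 1} =
          ⋃ z, {a | G.Adj x z ∧ x ∈ f a ∧ z ∈ f a} ∩
            {a | ∃ w : (openSubgraph G (f a)).Walk z y, w.length = n} := by
        ext a
        simp only [Set.mem_ofPred_eq, Set.mem_iUnion, Set.mem_inter_iff]
        constructor
        · rintro ⟨w, hw⟩
          cases w with
          | nil => simp at hw
          | cons h p => exact ⟨_, h, p, by simpa using hw⟩
        · rintro ⟨z, h, p, hp⟩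
          have hadj : (openSubgraph G (f a)).Adj x z := h
          exact ⟨SimpleGraph.Walk.cons hadj p, by rw [SimpleGraph.Walk.length_cons, hp]⟩
      rw [this]
      refine MeasurableSet.iUnion fun z => MeasurableSet.inter ?_ (ih z)
      refine MeasurableSet.inter (MeasurableSet.const _) (MeasurableSet.inter ?_ ?_)
      · exact measurableSet_setOfPred.mpr ((measurable_set_mem x).comp hf)
      · exact measurableSet_setOfPred.mpr ((measurable_set_mem z).comp hf)
  have : {a | Joined G (f a) x y} =
      ⋃ n, {a | ∃ w : (openSubgraph G (f a)).Walk x y, w.length = n} := by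
    ext a
    simp only [Set.mem_ofPred_eq, Set.mem_iUnion]
    exact ⟨fun ⟨w⟩ => ⟨_, w, rfl⟩, fun ⟨_, w, _⟩ => ⟨w⟩⟩
  rw [this]
  exact MeasurableSet.iUnion fun n => key n x

theorem measurableSet_percolates (G : SimpleGraph V) {f : Ω → Set V} (hf : Measurable f) (x : V) :
    MeasurableSet {a | Percolates G (f a) x} := by
  have : {a | Percolates G (f a) x} =
      ⋂ F : Finset V, ⋃ y ∈ (F : Set V)ᶜ, {a | Joined G (f a) x y} := by
    ext a
    simp only [Set.mem_ofPred_eq, Set.mem_iInter, Set.mem_iUnion, Percolates]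
    constructor
    · intro h F
      obtain ⟨y, hy, hF⟩ := h.exists_notMem_finset F
      exact ⟨y, hF, hy⟩
    · intro h hfin
      obtain ⟨y, hF, hy⟩ := h hfin.toFinset
      exact hF (by simpa using hy)
  rw [this]
  exact MeasurableSet.iInter fun F => MeasurableSet.biUnion (Set.to_countable _) fun y _ =>
    measurableSet_joined G hf x y

end Measurability

/-! ### Two independent configurations -/

section Pairs

open Measure ProbabilityTheory unitInterval

variable {V : Type*} [Countable V]

/-- The law of two independent Bernoulli configurations. -/
noncomputable def pairLaw (V : Type*) (p ε : I) : Measure (Set V × Set V) :=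
  (setBernoulli Set.univ p).prod (setBernoulli Set.univ ε)

omit [Countable V] in
instance (p ε : I) : IsProbabilityMeasure (pairLaw V p ε) := by
  unfold pairLaw
  infer_instance

variable {p ε : I} {v : V} {D : Set (Set V × Set V)}

omit [Countable V] in
theorem measurable_fst_mem (v : V) : MeasurableSet {z : Set V × Set V | v ∈ z.1} :=
  measurableSet_setOfPred.mpr ((measurable_set_mem v).comp measurable_fst)

omit [Countable V] in
theorem measurable_snd_mem (v : V) : MeasurableSet {z : Set V × Set V | v ∈ z.2} :=
  measurableSet_setOfPred.mpr ((measurable_set_mem v).comp measurable_snd)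

theorem pairLaw_mem_fst_inter (hD : MeasurableSet D)
    (h1 : ∀ z, (insert v z.1, z.2) ∈ D ↔ z ∈ D) :
    pairLaw V p ε {z | v ∈ z.1 ∧ z ∈ D} = toNNReal p * pairLaw V p ε D := by
  have hm : MeasurableSet {z : Set V × Set V | v ∈ z.1 ∧ z ∈ D} := (measurable_fst_mem v).inter hD
  rw [pairLaw, prod_apply_symm hm, prod_apply_symm hD,
    ← lintegral_const_mul _ (measurable_measure_prodMk_right hD)]
  refine lintegral_congr fun η => ?_
  exact setBernoulli_mem_inter p v (D := (fun ω => (ω, η)) ⁻¹' D) (measurable_prodMk_right hD)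
    fun ω => h1 (ω, η)

theorem pairLaw_notMem_fst_inter (hD : MeasurableSet D)
    (h1 : ∀ z, (insert v z.1, z.2) ∈ D ↔ z ∈ D) :
    pairLaw V p ε {z | v ∉ z.1 ∧ z ∈ D} = toNNReal (σ p) * pairLaw V p ε D := by
  have hm : MeasurableSet {z : Set V × Set V | v ∉ z.1 ∧ z ∈ D} :=
    (measurable_fst_mem v).compl.inter hD
  rw [pairLaw, prod_apply_symm hm, prod_apply_symm hD,
    ← lintegral_const_mul _ (measurable_measure_prodMk_right hD)]
  refine lintegral_congr fun η => ?_
  exact setBernoulli_notMem_inter p v (D := (fun ω => (ω, η)) ⁻¹' D) (measurable_prodMk_right hD)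
    fun ω => h1 (ω, η)

theorem pairLaw_mem_snd_inter (hD : MeasurableSet D)
    (h2 : ∀ z, (z.1, insert v z.2) ∈ D ↔ z ∈ D) :
    pairLaw V p ε {z | v ∈ z.2 ∧ z ∈ D} = toNNReal ε * pairLaw V p ε D := by
  have hm : MeasurableSet {z : Set V × Set V | v ∈ z.2 ∧ z ∈ D} := (measurable_snd_mem v).inter hD
  rw [pairLaw, prod_apply hm, prod_apply hD,
    ← lintegral_const_mul _ (measurable_measure_prodMk_left hD)]
  refine lintegral_congr fun ω => ?_
  exact setBernoulli_mem_inter ε v (D := Prod.mk ω ⁻¹' D) (measurable_prodMk_left hD)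
    fun η => h2 (ω, η)

theorem pairLaw_mem_snd_sdiff_fst_inter (hD : MeasurableSet D)
    (h1 : ∀ z, (insert v z.1, z.2) ∈ D ↔ z ∈ D) (h2 : ∀ z, (z.1, insert v z.2) ∈ D ↔ z ∈ D) :
    pairLaw V p ε {z | v ∉ z.1 ∧ v ∈ z.2 ∧ z ∈ D} =
      toNNReal (σ p) * (toNNReal ε * pairLaw V p ε D) := by
  rw [← pairLaw_mem_snd_inter hD h2]
  exact pairLaw_notMem_fst_inter (D := {z | v ∈ z.2 ∧ z ∈ D}) ((measurable_snd_mem v).inter hD)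
    fun z => and_congr_right fun _ => h1 z

/-- The vertex is open in the first configuration, or closed there and sprinkled; these disjoint
cases give p + (1 - p)ε. -/
theorem pairLaw_mem_union_inter (hD : MeasurableSet D)
    (h1 : ∀ z, (insert v z.1, z.2) ∈ D ↔ z ∈ D) (h2 : ∀ z, (z.1, insert v z.2) ∈ D ↔ z ∈ D) :
    pairLaw V p ε {z | v ∈ z.1 ∪ z.2 ∧ z ∈ D} =
      (toNNReal p + toNNReal (σ p) * toNNReal ε) * pairLaw V p ε D := by
  have : {z : Set V × Set V | v ∈ z.1 ∪ z.2 ∧ z ∈ D} =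
      {z | v ∈ z.1 ∧ z ∈ D} ∪ {z | v ∉ z.1 ∧ v ∈ z.2 ∧ z ∈ D} := by
    ext z
    simp only [Set.mem_union, Set.mem_ofPred_eq]
    tauto
  rw [this, measure_union, pairLaw_mem_fst_inter hD h1, pairLaw_mem_snd_sdiff_fst_inter hD h1 h2]
  · ring
  · rw [Set.disjoint_left]
    exact fun z hz hz' => hz'.1 hz.1
  · exact (measurable_fst_mem v).compl.inter ((measurable_snd_mem v).inter hD)

/-- The probability that a finite set of vertices is open in the union of both configurations. -/
theorem pairLaw_subset_union (p ε : I) (F : Finset V) :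
    pairLaw V p ε {z | (F : Set V) ⊆ z.1 ∪ z.2} =
      (toNNReal p + toNNReal (σ p) * toNNReal ε) ^ F.card := by
  classical
  induction F using Finset.induction_on with
  | empty => simp
  | insert v F hv ih =>
    have hm : MeasurableSet {z : Set V × Set V | (F : Set V) ⊆ z.1 ∪ z.2} := by
      have : {z : Set V × Set V | (F : Set V) ⊆ z.1 ∪ z.2} =
          ⋂ u ∈ F, ({z | u ∈ z.1} ∪ {z | u ∈ z.2}) := by
        ext z
        simp [Set.subset_def]
      rw [this]
      exact Finset.measurableSet_biInter _ fun u _ =>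
        (measurable_fst_mem u).union (measurable_snd_mem u)
    have h1 : ∀ z : Set V × Set V, (F : Set V) ⊆ insert v (z.1 ∪ z.2) ↔ (F : Set V) ⊆ z.1 ∪ z.2 :=
      fun z => Set.subset_insert_iff_of_notMem (by simpa using hv)
    rw [Finset.card_insert_of_notMem hv, pow_succ', ← ih, ← pairLaw_mem_union_inter (v := v) hm]
    · congr 1
      ext z
      simp [Set.insert_subset_iff]
    · intro z
      simpa [Set.insert_union] using h1 z
    · intro z
      simpa [Set.union_insert] using h1 z

end Pairs

/-! ### Pivotal vertices -/

section Pivotal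

variable {V : Type*} {G : SimpleGraph V} {ω : Set V} {z : Set V × Set V} {x y v w : V}

theorem joined_of_walk_support {S : Set V} (p : (openSubgraph G ω).Walk x y)
    (h : ∀ u ∈ p.support, u ∈ S) : Joined G (ω ∩ S) x y := by
  induction p with
  | nil => exact Joined.refl _
  | cons ha p ih =>
    have h1 := h _ (SimpleGraph.Walk.start_mem_support _)
    have h2 : (openSubgraph G (ω ∩ S)).Adj _ _ :=
      ⟨ha.1, ⟨ha.2.1, h1⟩, ⟨ha.2.2, h _ (by simp)⟩⟩
    exact h2.reachable.trans (ih fun u hu => h u (by simp [hu]))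

/-- Either `x` is joined to `y` avoiding `v`, or `v` is joined to `y` avoiding `x`. -/
theorem Joined.sdiff_or_sdiff (h : Joined G ω x y) (hxv : x ≠ v) :
    Joined G (ω \ {v}) x y ∨ Joined G (ω \ {x}) v y := by
  classical
  obtain ⟨p, hp⟩ := h.exists_isPath
  -- A path from `x` never returns to `x`, so its part after `v` avoids `x`.
  by_cases hv : v ∈ p.support
  · right
    rw [Set.sdiff_eq]
    refine joined_of_walk_support (p.dropUntil v hv) ?_
    rintro u hu rfl
    have hspec := congrArg SimpleGraph.Walk.support (p.take_spec hv)
    rw [SimpleGraph.Walk.support_append] at hspec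
    have hnd := hp.support_nodup
    rw [← hspec, List.nodup_append] at hnd
    rw [← SimpleGraph.Walk.cons_tail_support, List.mem_cons] at hu
    rcases hu with hu | hu
    · exact hxv hu
    · exact hnd.2.2 u (SimpleGraph.Walk.start_mem_support _) u hu rfl
  · left
    rw [Set.sdiff_eq]
    refine joined_of_walk_support p ?_
    rintro u hu rfl
    exact hv hu

/-- After closing `v`, the vertex `x` is not joined, in the union of both configurations, to an
infinite cluster of the first configuration. -/
def Pivotal (G : SimpleGraph V) (z : Set V × Set V) (x v : V) : Prop :=
  v ≠ x ∧ ∀ y, Percolates G (z.1 \ {v}) y → ¬ Joined G ((z.1 ∪ z.2) \ {v}) x y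

/-- The infinite cluster of the first configuration stays unique when finitely many vertices are
closed. -/
def RobustlyUnique (G : SimpleGraph V) (ω : Set V) : Prop :=
  ∀ B : Finset V, UniquePercolation G (ω \ B)

theorem RobustlyUnique.unique (h : RobustlyUnique G ω) : UniquePercolation G ω := by
  simpa using h ∅

theorem RobustlyUnique.sdiff_singleton (h : RobustlyUnique G ω) (v : V) :
    UniquePercolation G (ω \ {v}) := by
  simpa using h {v}

theorem RobustlyUnique.sdiff_pair (h : RobustlyUnique G ω) (v w : V) :
    UniquePercolation G (ω \ {v, w}) := by
  classical
  simpa using h {v, w}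

/-- Closing an already closed vertex leaves the infinite cluster of `x` in place. -/
theorem Pivotal.mem (hx : Percolates G z.1 x) (h : Pivotal G z x v) : v ∈ z.1 := by
  by_contra hv
  refine h.2 x ?_ (Joined.refl x)
  rwa [Set.sdiff_singleton_eq_self hv]

theorem Pivotal.percolates (hz : RobustlyUnique G z.1) (hx : Percolates G z.1 x)
    (h : Pivotal G z x v) : Percolates G z.1 v := by
  obtain ⟨y, hy⟩ := (hz.sdiff_singleton v).1
  have hy' := hy.mono Set.sdiff_subset
  rcases (hz.unique.2 x y hx hy').sdiff_or_sdiff h.1.symm with h1 | h1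
  · exact absurd (h1.mono (Set.sdiff_subset_sdiff_left Set.subset_union_left)) (h.2 y hy)
  · exact hy'.of_joined (h1.mono Set.sdiff_subset).symm

/-- Every route from `x` to infinity passes `v`, and from there it must pass `w`. Infinity is
represented by one vertex `y` that percolates with both `v` and `w` closed. -/
theorem Pivotal.trans (hz : RobustlyUnique G z.1) (hx : Percolates G z.1 x)
    (hv : Pivotal G z x v) (hw : Pivotal G z v w) : Pivotal G z x w := by
  obtain ⟨y, hy⟩ := (hz.sdiff_pair v w).1
  have hyv : Percolates G (z.1 \ {v}) y := hy.mono (Set.sdiff_subset_sdiff_right (by simp))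
  have hyw : Percolates G (z.1 \ {w}) y := hy.mono (Set.sdiff_subset_sdiff_right (by simp))
  constructor
  -- Two vertices cannot be pivotal for each other: a path from the first to `y` avoids the second,
  -- or its tail from the second avoids the first.
  · rintro rfl
    have h1 := hz.unique.2 w y hx (hyv.mono Set.sdiff_subset)
    rcases h1.sdiff_or_sdiff hv.1.symm with h2 | h2
    · exact hv.2 y hyv (h2.mono (Set.sdiff_subset_sdiff_left Set.subset_union_left))
    · exact hw.2 y hyw (h2.mono (Set.sdiff_subset_sdiff_left Set.subset_union_left))
  · intro y' hy' hj
    have h1 : Joined G ((z.1 ∪ z.2) \ {w}) x y :=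
      hj.trans (((hz.sdiff_singleton w).2 y' y hy' hyw).mono
        (Set.sdiff_subset_sdiff_left Set.subset_union_left))
    rcases h1.sdiff_or_sdiff hv.1.symm with h2 | h2
    · exact hv.2 y hyv (h2.mono (Set.sdiff_subset_sdiff_left Set.sdiff_subset))
    · exact hw.2 y hyw (h2.mono Set.sdiff_subset)

/-- Passing from `x` to a pivotal `v` strictly shrinks the finite set of pivotal vertices: by
transitivity none is gained, and `v` itself is lost. -/
theorem exists_percolates_forall_not_pivotal (hz : RobustlyUnique G z.1)
    (hfin : ∀ x, Percolates G z.1 x → {v | Pivotal G z x v}.Finite) :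
    ∃ c, Percolates G z.1 c ∧ ∀ v, ¬ Pivotal G z c v := by
  have key : ∀ (n : ℕ) (x : V), Percolates G z.1 x → {v | Pivotal G z x v}.ncard = n →
      ∃ c, Percolates G z.1 c ∧ ∀ v, ¬ Pivotal G z c v := by
    intro n
    induction n using Nat.strong_induction_on with
    | _ n ih =>
      intro x hx hn
      by_cases h : ∃ v, Pivotal G z x v
      · obtain ⟨v, hv⟩ := h
        refine ih _ ?_ v (hv.percolates hz hx) rfl
        rw [← hn]
        refine Set.ncard_lt_ncard ⟨fun w hw => hv.trans hz hx hw, fun hsub => ?_⟩ (hfin x hx)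
        exact (hsub hv : Pivotal G z v v).1 rfl
      · push Not at h
        exact ⟨x, hx, h⟩
  obtain ⟨x, hx⟩ := hz.unique.1
  exact key _ x hx rfl

/-- The vertex `x` is joined to an infinite cluster of the first configuration if `v` is open, but
not, even in the union of both configurations, if `v` is closed. -/
def pivotalEvent (G : SimpleGraph V) (x v : V) : Set (Set V × Set V) :=
  {z | (∃ y, Percolates G (z.1 \ {v}) y ∧ Joined G (insert v z.1) x y) ∧
    ∀ y, Percolates G (z.1 \ {v}) y → ¬ Joined G ((z.1 ∪ z.2) \ {v}) x y}

theorem Pivotal.mem_pivotalEvent (hz : RobustlyUnique G z.1) (hx : Percolates G z.1 x)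
    (h : Pivotal G z x v) : z ∈ pivotalEvent G x v := by
  obtain ⟨y, hy⟩ := (hz.sdiff_singleton v).1
  exact ⟨⟨y, hy, (hz.unique.2 x y hx (hy.mono Set.sdiff_subset)).mono (Set.subset_insert _ _)⟩,
    h.2⟩

/-- The event is phrased with `v` forced open or forced closed, so it is independent of the status
of `v` in either configuration. -/
theorem pivotalEvent_insert_fst (x v : V) (z : Set V × Set V) :
    (insert v z.1, z.2) ∈ pivotalEvent G x v ↔ z ∈ pivotalEvent G x v := by
  simp [pivotalEvent, Set.insert_union]

theorem pivotalEvent_insert_snd (x v : V) (z : Set V × Set V) :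
    (z.1, insert v z.2) ∈ pivotalEvent G x v ↔ z ∈ pivotalEvent G x v := by
  simp [pivotalEvent, Set.union_insert]

/-- Sprinkled pivotal vertices are unique. -/
theorem eq_of_mem_pivotalEvent (hv1 : v ∉ z.1) (hv : z ∈ pivotalEvent G x v)
    (hw1 : w ∉ z.1) (hw2 : w ∈ z.2) (hw : z ∈ pivotalEvent G x w) : v = w := by
  by_contra hne
  obtain ⟨⟨y, hy, hj⟩, -⟩ := hw
  rw [Set.sdiff_singleton_eq_self hw1] at hy
  -- The connection that `w` would open already lies in the union, as `w` is sprinkled, and it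
  -- avoids `v`, which is closed in the first configuration.
  refine hv.2 y (by rwa [Set.sdiff_singleton_eq_self hv1]) (hj.mono ?_)
  intro u hu
  rcases hu with rfl | hu
  · exact ⟨Or.inr hw2, fun h => hne h.symm⟩
  · refine ⟨Or.inl hu, ?_⟩
    rintro rfl
    exact hv1 hu

end Pivotal

/-! ### Finiteness of the set of pivotal vertices -/

section FinitePivotal

open Measure ProbabilityTheory unitInterval

variable {V : Type*} [Countable V] {G : SimpleGraph V}

theorem measurableSet_pivotalEvent (G : SimpleGraph V) (x v : V) :
    MeasurableSet (pivotalEvent G x v) := by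
  have h1 : Measurable fun z : Set V × Set V => z.1 \ {v} :=
    (measurable_sdiff_const _).comp measurable_fst
  have h2 : Measurable fun z : Set V × Set V => insert v z.1 := by
    rw [measurable_set_iff]
    intro a
    exact measurable_const.or ((measurable_set_mem a).comp measurable_fst)
  have h3 : Measurable fun z : Set V × Set V => (z.1 ∪ z.2) \ {v} := by
    rw [measurable_set_iff]
    intro a
    exact (((measurable_set_mem a).comp measurable_fst).or
      ((measurable_set_mem a).comp measurable_snd)).and measurable_const
  have : pivotalEvent G x v =
      (⋃ y, {z | Percolates G (z.1 \ {v}) y} ∩ {z | Joined G (insert v z.1) x y}) ∩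
      ⋂ y, ({z | Percolates G (z.1 \ {v}) y}ᶜ ∪ {z | Joined G ((z.1 ∪ z.2) \ {v}) x y}ᶜ) := by
    ext z
    simp only [pivotalEvent, Set.mem_ofPred_eq, Set.mem_inter_iff, Set.mem_iUnion, Set.mem_iInter,
      Set.mem_union, Set.mem_compl_iff, imp_iff_not_or]
  rw [this]
  refine MeasurableSet.inter (MeasurableSet.iUnion fun y => ?_) (MeasurableSet.iInter fun y => ?_)
  · exact (measurableSet_percolates G h1 y).inter (measurableSet_joined G h2 x y)
  · exact (measurableSet_percolates G h1 y).compl.union (measurableSet_joined G h3 x y).compl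

/-- For distinct `v` the sprinkled events are disjoint, so (1 - p)ε ∑ P(`pivotalEvent`) ≤ 1.
Replacing the sprinkled status by openness in the first configuration only changes the constant
factor to p. -/
theorem tsum_pairLaw_pivotalEvent_ne_top {p ε : I} (hp : toNNReal (σ p) ≠ 0)
    (hε : toNNReal ε ≠ 0) (x : V) :
    ∑' v, pairLaw V p ε {z | v ∈ z.1 ∧ z ∈ pivotalEvent G x v} ≠ ∞ := by
  have h1 : ∀ v, pairLaw V p ε {z | v ∈ z.1 ∧ z ∈ pivotalEvent G x v} =
      toNNReal p * pairLaw V p ε (pivotalEvent G x v) := fun v =>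
    pairLaw_mem_fst_inter (measurableSet_pivotalEvent G x v) (pivotalEvent_insert_fst x v)
  have h2 : ∀ v, pairLaw V p ε {z | v ∉ z.1 ∧ v ∈ z.2 ∧ z ∈ pivotalEvent G x v} =
      toNNReal (σ p) * (toNNReal ε * pairLaw V p ε (pivotalEvent G x v)) := fun v =>
    pairLaw_mem_snd_sdiff_fst_inter (measurableSet_pivotalEvent G x v)
      (pivotalEvent_insert_fst x v) (pivotalEvent_insert_snd x v)
  have h3 : ∑' v, pairLaw V p ε {z | v ∉ z.1 ∧ v ∈ z.2 ∧ z ∈ pivotalEvent G x v} ≤ 1 := by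
    rw [← measure_iUnion]
    · exact prob_le_one
    · intro v w hvw
      rw [Function.onFun, Set.disjoint_left]
      rintro z ⟨hv1, hv2, hv⟩ ⟨hw1, hw2, hw⟩
      exact hvw (eq_of_mem_pivotalEvent hv1 hv hw1 hw2 hw)
    · intro v
      exact (measurable_fst_mem v).compl.inter
        ((measurable_snd_mem v).inter (measurableSet_pivotalEvent G x v))
  simp_rw [h2, ENNReal.tsum_mul_left] at h3
  simp_rw [h1, ENNReal.tsum_mul_left]
  refine ENNReal.mul_ne_top ENNReal.coe_ne_top fun htop => ?_
  rw [htop, ENNReal.mul_top (by simpa using hε), ENNReal.mul_top (by simpa using hp)] at h3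
  simp at h3

/-- Almost surely, no vertex of the infinite cluster has infinitely many pivotal vertices. -/
theorem ae_finite_pivotal {p ε : I} (hp : toNNReal (σ p) ≠ 0) (hε : toNNReal ε ≠ 0)
    (hz : ∀ᵐ z ∂pairLaw V p ε, RobustlyUnique G z.1) :
    ∀ᵐ z ∂pairLaw V p ε, ∀ x, Percolates G z.1 x → {v | Pivotal G z x v}.Finite := by
  have h : ∀ᵐ z ∂pairLaw V p ε, ∀ x, {v | v ∈ z.1 ∧ z ∈ pivotalEvent G x v}.Finite :=
    ae_all_iff.mpr fun x => ae_finite_setOfPred_mem (tsum_pairLaw_pivotalEvent_ne_top hp hε x)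
  filter_upwards [h, hz] with z h1 h2 x hx
  exact (h1 x).subset fun v hv => ⟨hv.mem hx, hv.mem_pivotalEvent h2 hx⟩

end FinitePivotal

/-! ### Cycles through a vertex that meet a connected set -/

section CyclesThroughVertex

variable {V : Type*} {X : SimpleGraph V}

open SimpleGraph

theorem notMem_tail_support_of_isPath {u v : V} {p : X.Walk u v} (hp : p.IsPath) :
    u ∉ p.support.tail := by
  have h := hp.support_nodup
  rw [← Walk.cons_tail_support, List.nodup_cons] at h
  exact h.1

theorem isPath_append {u v w : V} {p : X.Walk u v} {q : X.Walk v w} (hp : p.IsPath)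
    (hq : q.IsPath) (h : ∀ x ∈ p.support, x ∈ q.support → x = v) : (p.append q).IsPath := by
  rw [Walk.isPath_def, Walk.support_append, List.nodup_append']
  refine ⟨hp.support_nodup, hq.support_nodup.tail, fun x hx hx' => ?_⟩
  have := h x hx (List.mem_of_mem_tail hx')
  subst this
  exact notMem_tail_support_of_isPath hq hx'

theorem isCycle_append_of_isPath {u v : V} {p : X.Walk u v} {q : X.Walk v u} (hp : p.IsPath)
    (hq : q.IsPath) (h : ∀ x ∈ p.support, x ∈ q.support → x = u ∨ x = v)
    (hn : 1 < p.length ∨ 1 < q.length) : (p.append q).IsCycle := by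
  refine hp.isCycle_append hq (fun x hx hx' => ?_) hn
  rcases h x (List.mem_of_mem_tail hx) (List.mem_of_mem_tail hx') with rfl | rfl
  · exact notMem_tail_support_of_isPath hp hx
  · exact notMem_tail_support_of_isPath hq hx'

/-- Any two vertices of `T` are joined by a walk inside `T`. -/
def ConnectedIn (X : SimpleGraph V) (T : Set V) : Prop :=
  ∀ s ∈ T, ∀ t ∈ T, ∃ w : X.Walk s t, ∀ u ∈ w.support, u ∈ T

/-- A walk from `A` to `T` contains a path that meets `A` and `T` in its endpoints only. -/
theorem exists_isPath_between {A T : Set V} {a t : V} (Q : X.Walk a t) (ha : a ∈ A)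
    (ht : t ∈ T) :
    ∃ z ∈ A, ∃ t' ∈ T, ∃ R : X.Walk z t', R.IsPath ∧ (∀ u ∈ R.support, u ∈ Q.support) ∧
      (∀ u ∈ R.support, u ∈ A → u = z) ∧ ∀ u ∈ R.support, u ∈ T → u = t' := by
  classical
  -- A shortest walk from `A` to `T` within the support of `Q` is a path and has no inner vertex in
  -- `A` or `T`.
  let S : Set ℕ := {n | ∃ z ∈ A, ∃ t' ∈ T, ∃ R : X.Walk z t',
    (∀ u ∈ R.support, u ∈ Q.support) ∧ R.length = n}
  have hS : S.Nonempty := ⟨Q.length, a, ha, t, ht, Q, fun _ h => h, rfl⟩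
  obtain ⟨z, hz, t', ht', R, hR, hlen⟩ := Nat.sInf_mem hS
  have hmin : ∀ {z₁ t₁ : V} (R₁ : X.Walk z₁ t₁), z₁ ∈ A → t₁ ∈ T →
      (∀ u ∈ R₁.support, u ∈ R.support) → R.length ≤ R₁.length := fun R₁ h1 h2 h3 => by
    rw [hlen]
    exact Nat.sInf_le ⟨_, h1, _, h2, R₁, fun u hu => hR u (h3 u hu), rfl⟩
  have hpath : R.bypass = R :=
    R.bypass_eq_self_of_length_le_length_bypass (hmin R.bypass hz ht' fun _ hu =>
      R.support_bypass_subset_support hu)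
  refine ⟨z, hz, t', ht', R, hpath ▸ R.bypass_isPath, hR, fun u hu huA => ?_, fun u hu huT => ?_⟩
  · by_contra hne
    have h1 := hmin (R.dropUntil u hu) huA ht' fun x hx => R.support_dropUntil_subset_support hu hx
    have h2 := R.length_dropUntil_lt_length hu hne
    omega
  · by_contra hne
    have h1 := hmin (R.takeUntil u hu) hz huT fun x hx => R.support_takeUntil_subset_support hu hx
    have h2 := R.length_takeUntil_lt_length hu hne
    omega

theorem ConnectedIn.exists_isPath {T : Set V} (hT : ConnectedIn X T) {s t : V} (hs : s ∈ T)
    (ht : t ∈ T) : ∃ w : X.Walk s t, w.IsPath ∧ ∀ u ∈ w.support, u ∈ T := by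
  classical
  obtain ⟨w, hw⟩ := hT s hs t ht
  exact ⟨w.bypass, w.bypass_isPath, fun u hu => hw u (w.support_bypass_subset_support hu)⟩

theorem ConnectedIn.union_support {T : Set V} (hT : ConnectedIn X T) {y t : V} (P : X.Walk y t)
    (ht : t ∈ T) : ConnectedIn X (T ∪ {u | u ∈ P.support}) := by
  classical
  have key : ∀ s ∈ T ∪ {u | u ∈ P.support}, ∃ w : X.Walk s t,
      ∀ u ∈ w.support, u ∈ T ∪ {u | u ∈ P.support} := by
    rintro s (hs | hs)
    · obtain ⟨w, hw⟩ := hT s hs t ht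
      exact ⟨w, fun u hu => Or.inl (hw u hu)⟩
    · exact ⟨P.dropUntil s hs, fun u hu => Or.inr (P.support_dropUntil_subset_support hs hu)⟩
  intro s hs s' hs'
  obtain ⟨w, hw⟩ := key s hs
  obtain ⟨w', hw'⟩ := key s' hs'
  refine ⟨w.append w'.reverse, fun u hu => ?_⟩
  rw [Walk.mem_support_append_iff, Walk.support_reverse, List.mem_reverse] at hu
  exact hu.elim (hw u) (hw' u)

/-- A path from `c` to a connected set, together with a neighbour of `c` in this set different from
the end of the path, gives a cycle through `c`. -/
theorem exists_isCycle_of_adj {T : Set V} (hT : ConnectedIn X T) {c a t : V} (hcT : c ∉ T)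
    (ha : a ∈ T) (hca : X.Adj c a) (ht : t ∈ T) (Q : X.Walk c t) (hQ : a ∉ Q.support) :
    ∃ C : X.Walk c c, C.IsCycle ∧ a ∈ C.support := by
  obtain ⟨z, rfl, t', ht', R, hR, hRQ, -, hRT⟩ :=
    exists_isPath_between (A := {c}) Q (Set.mem_singleton c) ht
  obtain ⟨U, hU, hUT⟩ := hT.exists_isPath ht' ha
  have hne : t' ≠ a := by
    rintro rfl
    exact hQ (hRQ _ R.end_mem_support)
  refine ⟨(R.append U).append (Walk.cons hca.symm Walk.nil), ?_, by simp⟩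
  refine isCycle_append_of_isPath (isPath_append hR hU fun x hx hx' => hRT x hx (hUT x hx'))
    (by simp [hca.ne']) (fun x _ hx' => by simpa [or_comm] using hx') (Or.inl ?_)
  have h1 : 0 < R.length := by
    rw [Nat.pos_iff_ne_zero]
    intro h
    exact hcT (Walk.eq_of_length_eq_zero h ▸ ht')
  have h2 : 0 < U.length := by
    rw [Nat.pos_iff_ne_zero]
    intro h
    exact hne (Walk.eq_of_length_eq_zero h)
  rw [Walk.length_append]
  omega

/-- The new cycle follows `α` to `z`, then `R` to `T`, `U` inside `T` to `a'`, the edge to `a`, and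
`β` backwards to `c`. Here `α` and `β` are the two arcs of the old cycle. -/
theorem exists_isCycle_of_ear_aux {c a a' z t' : V} {T : Set V} {α β : X.Walk c a}
    (hα : α.IsPath) (hβ : β.IsPath) (hαβ : ∀ u ∈ α.support, u ∈ β.support → u = c ∨ u = a)
    (hca : c ≠ a) (hαT : ∀ u ∈ α.support, u ∉ T) (hβT : ∀ u ∈ β.support, u ∉ T)
    (haa' : X.Adj a a') (ha' : a' ∈ T) (hz : z ∈ α.support) (hza : z ≠ a)
    {R : X.Walk z t'} (hR : R.IsPath) (hRα : ∀ u ∈ R.support, u ∈ α.support → u = z)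
    (hRβ : ∀ u ∈ R.support, u ∈ β.support → u = z) (hRT : ∀ u ∈ R.support, u ∈ T → u = t')
    {U : X.Walk t' a'} (hU : U.IsPath) (hUT : ∀ u ∈ U.support, u ∈ T) :
    ∃ C : X.Walk c c, C.IsCycle ∧ a' ∈ C.support := by
  classical
  have hpR : ((α.takeUntil z hz).append R).IsPath :=
    isPath_append (hα.takeUntil hz) hR fun x hx hx' =>
      hRα x hx' (α.support_takeUntil_subset_support hz hx)
  have hpU : (((α.takeUntil z hz).append R).append U).IsPath := by
    refine isPath_append hpR hU fun x hx hx' => ?_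
    rcases (Walk.mem_support_append_iff _ _).mp hx with h | h
    · exact absurd (hUT x hx') (hαT x (α.support_takeUntil_subset_support hz h))
    · exact hRT x h (hUT x hx')
  have hq : (Walk.cons haa'.symm β.reverse).IsPath := by
    rw [Walk.cons_isPath_iff]
    refine ⟨hβ.reverse, fun h => hβT a' ?_ ha'⟩
    simpa using h
  refine ⟨_, isCycle_append_of_isPath hpU hq (fun x hx hx' => ?_) (Or.inr ?_), by simp⟩
  · rw [Walk.support_cons, List.mem_cons, Walk.support_reverse, List.mem_reverse] at hx'
    rcases hx' with rfl | hxβ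
    · exact Or.inr rfl
    rcases (Walk.mem_support_append_iff _ _).mp hx with h | h
    · rcases (Walk.mem_support_append_iff _ _).mp h with h | h
      · rcases hαβ x (α.support_takeUntil_subset_support hz h) hxβ with h1 | rfl
        · exact Or.inl h1
        · exact absurd h (Walk.endpoint_notMem_support_takeUntil hα hz hza.symm)
      · have hxz := hRβ x h hxβ
        subst hxz
        rcases hαβ x hz hxβ with h1 | h1
        · exact Or.inl h1
        · exact absurd h1 hza
    · exact absurd (hUT x h) (hβT x hxβ)
  · rw [Walk.length_cons, Walk.length_reverse]
    have : 0 < β.length := by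
      rw [Nat.pos_iff_ne_zero]
      intro h
      exact hca (Walk.eq_of_length_eq_zero h)
    omega

/-- A cycle through `c` and `a` can be replaced by one through a neighbour `a'` of `a` in a
connected set which can be reached from `c` without using `a`. -/
theorem exists_isCycle_of_ear {T : Set V} (hT : ConnectedIn X T) {c a a' t : V}
    {C : X.Walk c c} (hC : C.IsCycle) (haC : a ∈ C.support) (hca : c ≠ a)
    (hCT : ∀ u ∈ C.support, u ∉ T) (haa' : X.Adj a a') (ha' : a' ∈ T) (ht : t ∈ T)
    (Q : X.Walk c t) (hQ : a ∉ Q.support) :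
    ∃ C' : X.Walk c c, C'.IsCycle ∧ a' ∈ C'.support := by
  classical
  have hspec := C.take_spec haC
  set α := C.takeUntil a haC with hαdef
  set β := C.dropUntil a haC with hβdef
  have hmem : ∀ u, u ∈ C.support ↔ u ∈ α.support ∨ u ∈ β.support := by
    intro u
    rw [← hspec, Walk.mem_support_append_iff]
  have hα : α.IsPath := hC.isPath_takeUntil haC
  have hαnil : ¬ α.Nil := Walk.not_nil_of_ne hca
  have hβ : β.IsPath := Walk.IsCycle.isPath_of_append_right hαnil (by rwa [hspec])
  have hαβ : ∀ u ∈ α.support, u ∈ β.support → u = c ∨ u = a := by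
    intro u hu hu'
    have hnd := hC.support_nodup
    rw [← hspec, Walk.tail_support_append, List.nodup_append'] at hnd
    rw [Walk.mem_support_iff] at hu hu'
    rcases hu with hu | hu
    · exact Or.inl hu
    rcases hu' with hu' | hu'
    · exact Or.inr hu'
    exact absurd hu' (hnd.2.2 hu)
  obtain ⟨z, hzC, t', ht', R, hR, hRQ, hRC, hRT⟩ :=
    exists_isPath_between (A := {u | u ∈ C.support}) Q C.start_mem_support ht
  obtain ⟨U, hU, hUT⟩ := hT.exists_isPath ht' ha'
  have hza : z ≠ a := by
    rintro rfl
    exact hQ (hRQ _ R.start_mem_support)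
  have hRα : ∀ u ∈ R.support, u ∈ α.support → u = z := fun u hu hu' =>
    hRC u hu ((hmem u).mpr (Or.inl hu'))
  have hRβ : ∀ u ∈ R.support, u ∈ β.support → u = z := fun u hu hu' =>
    hRC u hu ((hmem u).mpr (Or.inr hu'))
  have hαT : ∀ u ∈ α.support, u ∉ T := fun u hu => hCT u ((hmem u).mpr (Or.inl hu))
  have hβT : ∀ u ∈ β.support, u ∉ T := fun u hu => hCT u ((hmem u).mpr (Or.inr hu))
  -- The ear leaves the cycle on one of its two arcs; reversing `β` makes their roles symmetric.
  rcases (hmem z).mp hzC with hz | hz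
  · exact exists_isCycle_of_ear_aux (β := β.reverse) hα hβ.reverse
      (fun u hu hu' => hαβ u hu (by simpa using hu')) hca hαT
      (fun u hu => hβT u (by simpa using hu)) haa' ha' hz hza hR hRα
      (fun u hu hu' => hRβ u hu (by simpa using hu')) hRT hU hUT
  · exact exists_isCycle_of_ear_aux (α := β.reverse) hβ.reverse hα
      (fun u hu hu' => hαβ u hu' (by simpa using hu)) hca
      (fun u hu => hβT u (by simpa using hu)) hαT haa' ha' (by simpa using hz) hza hR
      (fun u hu hu' => hRβ u hu (by simpa using hu')) hRα hRT hU hUT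

/-- Induction along `P` towards `T`: a cycle that misses `T` and the rest of `P` passes through the
first vertex of `P`, and an ear avoiding that vertex moves it on to the next one. -/
theorem exists_isCycle_meeting_of_walk {T : Set V} (hT : ConnectedIn X T) {c : V}
    (hsep : ∀ v, v ≠ c → ∃ t ∈ T, ∃ Q : X.Walk c t, v ∉ Q.support) {y t : V} (P : X.Walk y t)
    (ht : t ∈ T) (hcP : c ∉ P.support)
    (hC : ∃ C : X.Walk c c, C.IsCycle ∧ ∃ u ∈ C.support, u ∈ T ∪ {u | u ∈ P.support}) :
    ∃ C : X.Walk c c, C.IsCycle ∧ ∃ u ∈ C.support, u ∈ T := by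
  induction P with
  | nil =>
    obtain ⟨C, hC, u, hu, huT⟩ := hC
    refine ⟨C, hC, u, hu, ?_⟩
    rcases huT with h | h
    · exact h
    · have h1 := Walk.mem_support_nil_iff.mp h
      exact h1 ▸ ht
  | @cons y y' t hadj P ih =>
    have hcP' : c ∉ P.support := fun h => hcP (by simp [h])
    have hcy : c ≠ y := by
      rintro rfl
      exact hcP (by simp)
    obtain ⟨C, hC, u, hu, huT⟩ := hC
    refine ih ht hcP' ?_
    by_cases hmeet : ∃ u ∈ C.support, u ∈ T ∪ {u | u ∈ P.support}
    · exact ⟨C, hC, hmeet⟩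
    · push Not at hmeet
      have huy : u = y := by
        by_contra hne
        refine hmeet u hu ?_
        rcases huT with h | h
        · exact Or.inl h
        · exact Or.inr (by simpa [hne] using h)
      subst huy
      obtain ⟨t₁, ht₁, Q, hQ⟩ := hsep u hcy.symm
      obtain ⟨C', hC', hC'y⟩ := exists_isCycle_of_ear (hT.union_support P ht) hC hu hcy hmeet hadj
        (Or.inr P.start_mem_support) (Or.inl ht₁) Q hQ
      exact ⟨C', hC', y', hC'y, Or.inr P.start_mem_support⟩

/-- If no vertex separates `c` from the connected set `T`, then some cycle through `c`
meets `T`. -/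
theorem exists_isCycle_meeting {T : Set V} (hT : ConnectedIn X T) {c : V} (hcT : c ∉ T)
    (hreach : ∃ t ∈ T, X.Reachable c t)
    (hsep : ∀ v, v ≠ c → ∃ t ∈ T, ∃ Q : X.Walk c t, v ∉ Q.support) :
    ∃ C : X.Walk c c, C.IsCycle ∧ ∃ u ∈ C.support, u ∈ T := by
  obtain ⟨t, ht, hct⟩ := hreach
  obtain ⟨P, hP⟩ := hct.exists_isPath
  cases P with
  | nil => exact absurd ht hcT
  | @cons _ y _ hadj P =>
    rw [Walk.cons_isPath_iff] at hP
    refine exists_isCycle_meeting_of_walk hT hsep P ht hP.2 ?_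
    -- The first cycle comes from the edge from `c` to `y` and a route to `T` that avoids `y`.
    obtain ⟨t₁, ht₁, Q, hQ⟩ := hsep y hadj.ne'
    obtain ⟨C, hC, hyC⟩ := exists_isCycle_of_adj (hT.union_support P ht)
      (by rintro (h | h); exacts [hcT h, hP.2 h]) (Or.inr P.start_mem_support) hadj
      (Or.inl ht₁) Q hQ
    exact ⟨C, hC, y, hyC, Or.inr P.start_mem_support⟩

end CyclesThroughVertex

/-! ### Arbitrarily long open cycles -/

section LongCycles

open SimpleGraph

variable {V : Type*} {G : SimpleGraph V} {ω : Set V} {z : Set V × Set V} {c : V}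

theorem mem_of_mem_support_openSubgraph {x y u : V} (p : (openSubgraph G ω).Walk x y)
    (hu : u ∈ p.support) (hne : u ≠ x) : u ∈ ω := by
  classical
  exact Joined.mem_left (y := x) ⟨(p.takeUntil u hu).reverse⟩ hne

open Classical in
/-- The vertices reached by walks of length at most `n`. -/
noncomputable def walkBall (G : SimpleGraph V) [G.LocallyFinite] : ℕ → V → Finset V
  | 0, x => {x}
  | n + 1, x => insert x ((G.neighborFinset x).biUnion (walkBall G n))

theorem mem_walkBall [G.LocallyFinite] {x y : V} (p : G.Walk x y) {n : ℕ} (h : p.length ≤ n) :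
    y ∈ walkBall G n x := by
  classical
  induction p generalizing n with
  | nil => cases n <;> simp [walkBall]
  | cons hadj p ih =>
    cases n with
    | zero => simp at h
    | succ n =>
      rw [walkBall, Finset.mem_insert, Finset.mem_biUnion]
      refine Or.inr ⟨_, by simpa using hadj, ih (by simpa using h)⟩

theorem self_mem_walkBall [G.LocallyFinite] (n : ℕ) (x : V) : x ∈ walkBall G n x :=
  mem_walkBall (Walk.nil : G.Walk x x) (Nat.zero_le n)

theorem connectedIn_percolates {B : Set V} {ω' : Set V} (hω : ω \ B ⊆ ω')
    (h : UniquePercolation G (ω \ B)) :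
    ConnectedIn (openSubgraph G ω') {y | Percolates G (ω \ B) y} := by
  classical
  intro s hs t ht
  obtain ⟨w⟩ := h.2 s t hs ht
  refine ⟨w.mapLe (openSubgraph_mono hω), fun u hu => ?_⟩
  rw [Walk.support_mapLe_eq_support] at hu
  exact hs.of_joined ⟨w.takeUntil u hu⟩

/-- In the absence of pivotal vertices there are arbitrarily long open cycles. -/
theorem exists_isCycle_le_length [G.LocallyFinite] (hz : RobustlyUnique G z.1)
    (hc : Percolates G z.1 c) (hpiv : ∀ v, ¬ Pivotal G z c v) (m : ℕ) :
    ∃ C : G.Walk c c, C.IsCycle ∧ m ≤ C.length ∧ ∀ u ∈ C.support, u ∈ z.1 ∪ z.2 := by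
  classical
  set B := walkBall G m c
  set X := openSubgraph G (z.1 ∪ z.2)
  -- `T` lies outside the ball `B`, so a cycle through `c` that meets it must be long.
  set T := {y | Percolates G (z.1 \ B) y}
  have hsubB : z.1 \ (B : Set V) ⊆ z.1 ∪ z.2 := Set.sdiff_subset.trans Set.subset_union_left
  have hT : ConnectedIn X T := connectedIn_percolates hsubB (hz B)
  have hcT : c ∉ T := fun h => (Percolates.mem h).2 (self_mem_walkBall m c)
  have hreach : ∃ t ∈ T, X.Reachable c t := by
    obtain ⟨t, ht⟩ := (hz B).1
    exact ⟨t, ht, (hz.unique.2 c t hc (ht.mono Set.sdiff_subset)).mono Set.subset_union_left⟩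
  have hsep : ∀ v, v ≠ c → ∃ t ∈ T, ∃ Q : X.Walk c t, v ∉ Q.support := by
    intro v hv
    have h1 := hpiv v
    simp only [Pivotal, not_and, not_forall, not_not] at h1
    obtain ⟨y, hy, hcy⟩ := h1 hv
    -- A vertex percolating with both `v` and `B` closed lies in `T` and in the cluster that `c`
    -- reaches without `v`.
    obtain ⟨t, ht⟩ := (hz (insert v B)).1
    have hB : Percolates G (z.1 \ B) t := ht.mono (Set.sdiff_subset_sdiff_right (by simp))
    have hv' : Percolates G (z.1 \ {v}) t := ht.mono (Set.sdiff_subset_sdiff_right (by simp))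
    obtain ⟨Q⟩ := hcy.trans (((hz.sdiff_singleton v).2 y t hy hv').mono
      (Set.sdiff_subset_sdiff_left Set.subset_union_left))
    refine ⟨t, hB, Q.mapLe (openSubgraph_mono Set.sdiff_subset), fun h => ?_⟩
    rw [Walk.support_mapLe_eq_support] at h
    exact (mem_of_mem_support_openSubgraph Q h hv).2 rfl
  obtain ⟨C, hC, u, hu, huT⟩ := exists_isCycle_meeting hT hcT hreach hsep
  have hle : X ≤ G := fun _ _ h => h.1
  refine ⟨C.mapLe hle, (Walk.isCycle_mapLe hle).mpr hC, ?_, fun x hx => ?_⟩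
  · by_contra hlt
    refine (Percolates.mem huT).2 (mem_walkBall ((C.mapLe hle).takeUntil u ?_) (n := m) ?_)
    · rwa [Walk.support_mapLe_eq_support]
    · exact ((C.mapLe hle).length_takeUntil_le_length _).trans (by omega)
  · rw [Walk.support_mapLe_eq_support] at hx
    by_cases hxc : x = c
    · exact Or.inl (hxc ▸ hc.mem)
    · exact mem_of_mem_support_openSubgraph C hx hxc

end LongCycles

/-! ### First-moment bound and the contradiction -/

section UnionBound

open Measure ProbabilityTheory unitInterval

variable {V : Type*} {G : SimpleGraph V}

/-- The configurations whose union contains a cycle through `c` of length at least `m`. -/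
def longCycleEvent (G : SimpleGraph V) (c : V) (m : ℕ) : Set (Set V × Set V) :=
  {z | ∃ C : G.Walk c c, C.IsCycle ∧ m ≤ C.length ∧ ∀ u ∈ C.support, u ∈ z.1 ∪ z.2}

theorem pairLaw_support_subset_le [Countable V] (p ε : I) {c : V} {C : G.Walk c c}
    (hC : C.IsCycle) :
    pairLaw V p ε {z | ∀ u ∈ C.support, u ∈ z.1 ∪ z.2} ≤
      (toNNReal p + toNNReal (σ p) * toNNReal ε : ℝ≥0∞) ^ C.length := by
  classical
  -- Dropping the first entry removes the repeated base point, leaving each vertex of the cycle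
  -- once.
  have hcard : C.support.tail.toFinset.card = C.length := by
    rw [List.toFinset_card_of_nodup hC.support_nodup, List.length_tail,
      SimpleGraph.Walk.length_support, Nat.add_sub_cancel]
  rw [← hcard, ← pairLaw_subset_union]
  refine measure_mono fun z hz u hu => hz u (List.mem_of_mem_tail ?_)
  simpa using hu

theorem pairLaw_longCycleEvent_le [Countable V] [G.LocallyFinite] {S : ℕ → G.Subgraph}
    [∀ t, Finite (S t).verts] (hmono : Monotone S) (hlim : ⨆ t, S t = ⊤) (p ε : I) (c : V)
    (m : ℕ) :
    pairLaw V p ε (longCycleEvent G c m) ≤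
      ∑' n, G.degree c * ((⨆ t, hashimotoRadius (S t).coe) ^ (n + m) *
        (toNNReal p + toNNReal (σ p) * toNNReal ε : ℝ≥0∞) ^ (n + m)) := by
  classical
  have : Countable (G.Walk c c) :=
    Function.Injective.countable (f := SimpleGraph.Walk.support) fun _ _ h =>
      SimpleGraph.Walk.ext_support h
  have hsub : longCycleEvent G c m ⊆ ⋃ n, ⋃ C : {C : G.Walk c c // C.IsCycle ∧ C.length = n + m},
      {z | ∀ u ∈ C.1.support, u ∈ z.1 ∪ z.2} := by
    rintro z ⟨C, hC, hm, hz⟩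
    exact Set.mem_iUnion₂.mpr ⟨C.length - m, ⟨C, hC, by omega⟩, hz⟩
  refine (measure_mono hsub).trans ((measure_iUnion_le _).trans (ENNReal.tsum_le_tsum fun n => ?_))
  refine (measure_iUnion_le _).trans ?_
  -- Finite subfamilies suffice, which is the form of `card_cycles_le`.
  rw [ENNReal.tsum_eq_iSup_sum]
  refine iSup_le fun F => ?_
  have hF : (F.card : ℝ≥0∞) ≤ G.degree c * (⨆ t, hashimotoRadius (S t).coe) ^ (n + m) := by
    rw [← Finset.card_map (Function.Embedding.subtype _)]
    refine card_cycles_le G hmono hlim c (n + m) _ fun w hw => ?_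
    obtain ⟨C, -, rfl⟩ := Finset.mem_map.mp hw
    exact C.2
  calc ∑ C ∈ F, pairLaw V p ε {z | ∀ u ∈ C.1.support, u ∈ z.1 ∪ z.2}
      ≤ F.card • (toNNReal p + toNNReal (σ p) * toNNReal ε : ℝ≥0∞) ^ (n + m) :=
        Finset.sum_le_card_nsmul _ _ _ fun C _ =>
          (pairLaw_support_subset_le p ε C.2.1).trans_eq (by rw [C.2.2])
    _ ≤ _ := by
        rw [nsmul_eq_mul, ← mul_assoc]
        exact mul_le_mul_left hF _

/-- In the summable regime there are almost surely no arbitrarily long open cycles. -/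
theorem ae_exists_notMem_longCycleEvent [Countable V] [G.LocallyFinite] {S : ℕ → G.Subgraph}
    [∀ t, Finite (S t).verts] (hmono : Monotone S) (hlim : ⨆ t, S t = ⊤) {p ε : I}
    (hlt : (⨆ t, hashimotoRadius (S t).coe) *
      (toNNReal p + toNNReal (σ p) * toNNReal ε : ℝ≥0∞) < 1) (c : V) :
    ∀ᵐ z ∂pairLaw V p ε, ∃ m, z ∉ longCycleEvent G c m := by
  set r : ℝ≥0∞ := (⨆ t, hashimotoRadius (S t).coe) *
      (toNNReal p + toNNReal (σ p) * toNNReal ε : ℝ≥0∞) with hr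
  have hle : ∀ m, pairLaw V p ε (⋂ m, longCycleEvent G c m) ≤
      r ^ m * (G.degree c * (1 - r)⁻¹) := fun m => by
    refine (measure_mono (Set.iInter_subset _ m)).trans
      ((pairLaw_longCycleEvent_le hmono hlim p ε c m).trans_eq ?_)
    simp_rw [← mul_pow, ← hr, pow_add]
    rw [ENNReal.tsum_mul_left, ENNReal.tsum_mul_right, ENNReal.tsum_geometric]
    ring
  have hne : (G.degree c : ℝ≥0∞) * (1 - r)⁻¹ ≠ ∞ :=
    ENNReal.mul_ne_top (ENNReal.natCast_ne_top _)
      (ENNReal.inv_ne_top.mpr (tsub_pos_iff_lt.mpr hlt).ne')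
  have hlim0 : Tendsto (fun m => r ^ m * (G.degree c * (1 - r)⁻¹)) atTop (𝓝 0) := by
    have := ENNReal.Tendsto.mul_const (ENNReal.tendsto_pow_atTop_nhds_zero_of_lt_one hlt)
      (Or.inr hne)
    simpa using this
  have h0 : pairLaw V p ε (⋂ m, longCycleEvent G c m) = 0 :=
    le_antisymm (ge_of_tendsto' hlim0 hle) zero_le
  refine ae_iff.mpr (measure_mono_null (fun z hz => ?_) h0)
  simp only [Set.mem_ofPred_eq, not_exists, not_not] at hz
  exact Set.mem_iInter.mpr hz

theorem exists_sprinkling {p : I} {ρ : ℝ≥0∞} (hρ : ρ ≠ ∞)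
    (h : ENNReal.ofReal (p : ℝ) * ρ < 1) :
    ∃ ε : I, toNNReal ε ≠ 0 ∧
      ρ * (toNNReal p + toNNReal (σ p) * toNNReal ε : ℝ≥0∞) < 1 := by
  lift ρ to NNReal using hρ
  have hp0 : (0 : ℝ) ≤ p := p.2.1
  have hr : (0 : ℝ) ≤ ρ := ρ.2
  have h' : (p : ℝ) * ρ < 1 := by
    have h1 : ENNReal.ofReal ((p : ℝ) * ρ) < 1 := by
      rw [ENNReal.ofReal_mul hp0]
      simpa using h
    simpa using h1
  -- This makes ρe at most half of the slack 1 - pρ; `ρ + 1` keeps the denominator positive at ρ =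
  -- 0.
  set e : ℝ := min 1 ((1 - p * ρ) / (2 * (ρ + 1))) with he
  have he0 : 0 < e := lt_min one_pos (div_pos (by linarith) (by linarith))
  have he1 : e ≤ 1 := min_le_left _ _
  have he2 : e * (2 * (ρ + 1)) ≤ 1 - p * ρ := by
    rw [← le_div_iff₀ (by linarith)]
    exact min_le_right _ _
  refine ⟨⟨e, he0.le, he1⟩, fun h0 => ?_, ?_⟩
  · exact he0.ne' (congrArg NNReal.toReal h0)
  · have key : ρ * (toNNReal p + toNNReal (σ p) * toNNReal ⟨e, he0.le, he1⟩) < 1 := by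
      rw [← NNReal.coe_lt_coe]
      push_cast
      change (ρ : ℝ) * ((p : ℝ) + (1 - (p : ℝ)) * e) < 1
      nlinarith [mul_nonneg (mul_nonneg hr hp0) he0.le]
    exact_mod_cast key

theorem toNNReal_symm_ne_zero {p : I} (hp : p ≠ 1) : toNNReal (σ p) ≠ 0 := by
  intro h
  have h1 : (1 : ℝ) - p = 0 := congrArg NNReal.toReal h
  exact hp (Subtype.ext (show (p : ℝ) = 1 by linarith))

/-- Below the inverse of the limiting spectral radius, the infinite cluster is not unique. -/
theorem not_ae_hasUniqueInfiniteCluster [G.LocallyFinite] {S : ℕ → G.Subgraph}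
    [∀ t, Finite (S t).verts] (hmono : Monotone S) (hlim : ⨆ t, S t = ⊤) {p : I} (hp : p ≠ 1)
    (hρ : ⨆ t, hashimotoRadius (S t).coe ≠ ∞)
    (hlt : ENNReal.ofReal (p : ℝ) * ⨆ t, hashimotoRadius (S t).coe < 1) :
    ¬ ∀ᵐ ω ∂setBernoulli (Set.univ : Set V) p, HasUniqueInfiniteCluster G ω := by
  intro hunique
  -- Countability of `V` comes from the exhaustion by finite vertex sets.
  have : Countable V := by
    have hcover : ⋃ t, (S t).verts = Set.univ := by
      rw [← SimpleGraph.Subgraph.verts_iSup, hlim, SimpleGraph.Subgraph.verts_top]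
    rw [← Set.countable_univ_iff, ← hcover]
    exact Set.countable_iUnion fun t => (Set.toFinite _).countable
  obtain ⟨ε, hε, hεlt⟩ := exists_sprinkling hρ hlt
  have hrobust : ∀ᵐ ω ∂setBernoulli (Set.univ : Set V) p, RobustlyUnique G ω :=
    ae_forall_finset_sdiff hp (hunique.mono fun _ h => h.uniquePercolation)
  have hrobust' : ∀ᵐ z ∂pairLaw V p ε, RobustlyUnique G z.1 :=
    quasiMeasurePreserving_fst.ae hrobust
  have hcycles : ∀ᵐ z ∂pairLaw V p ε, ∀ c, ∃ m, z ∉ longCycleEvent G c m :=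
    ae_all_iff.mpr (ae_exists_notMem_longCycleEvent hmono hlim hεlt)
  obtain ⟨z, hz, hfin, hno⟩ := (hrobust'.and
    ((ae_finite_pivotal (toNNReal_symm_ne_zero hp) hε hrobust').and hcycles)).exists
  obtain ⟨c, hc, hpiv⟩ := exists_percolates_forall_not_pivotal hz hfin
  obtain ⟨m, hm⟩ := hno c
  exact hm (exists_isCycle_le_length hz hc hpiv m)

end UnionBound

end SitePercolation

/-! ### The limit and the two bounds -/

theorem theorem5 {V : Type*} (G : SimpleGraph V) [G.LocallyFinite] (hG : G.Connected)
    (S : ℕ → G.Subgraph) [∀ t, Finite (S t).verts] (hmono : Monotone S) (hlim : ⨆ t, S t = ⊤) :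
    ∃ ρ₀ : ℝ≥0∞,
      Tendsto (fun t => SitePercolation.hashimotoRadius (S t).coe) atTop (𝓝 ρ₀) ∧
      (ρ₀ ≠ 0 → ρ₀⁻¹ ≤ SitePercolation.uniquenessTransition G) ∧
      (ρ₀ = 0 → 1 ≤ SitePercolation.uniquenessTransition G) := by
  refine ⟨⨆ t, SitePercolation.hashimotoRadius (S t).coe,
    tendsto_atTop_iSup (SitePercolation.hashimotoRadius_coe_monotone hmono), fun h0 => ?_,
    fun h0 => ?_⟩
  · refine le_iInf₂ fun p hp => ?_
    by_contra! hlt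
    -- A non-zero radius is at least 1, so p < 1/ρ₀ excludes p = 1, where closing a vertex would not
    -- be absolutely continuous.
    have hone : 1 ≤ ⨆ t, SitePercolation.hashimotoRadius (S t).coe := by
      obtain ⟨t, ht⟩ : ∃ t, SitePercolation.hashimotoRadius (S t).coe ≠ 0 := by
        by_contra! h
        exact h0 (by simp [h])
      exact ((SitePercolation.hashimotoRadius_eq_zero_or_one_le _).resolve_left ht).trans
        (le_iSup (fun t => SitePercolation.hashimotoRadius (S t).coe) t)
    refine SitePercolation.not_ae_hasUniqueInfiniteCluster hmono hlim ?_ ?_ ?_ hp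
    · rintro rfl
      have : (1 : ℝ≥0∞) < 1 := by
        simpa using hlt.trans_le (ENNReal.inv_le_one.mpr hone)
      exact lt_irrefl _ this
    · intro htop
      simp [htop] at hlt
    · rw [mul_comm]
      exact ENNReal.mul_lt_of_lt_div' (by simpa using hlt)
  · refine le_iInf₂ fun p hp => ?_
    by_contra! hlt
    refine SitePercolation.not_ae_hasUniqueInfiniteCluster hmono hlim ?_ ?_ ?_ hp
    · rintro rfl
      simp at hlt
    · simp [h0]
    · simp [h0]
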